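/- **Setting.** Let $M$ be a closed connected surface with a finite simplicial triangulation with vertex set $V$, edge set $E$ and triangle set $F$. Let $I:E\to(-1,+\infty)$ assign to each edge $\{ij\}$ an inversive distance $I_{ij}$, such that $$I_{ij}+I_{ik}I_{jk}\ge 0,\qquad I_{ik}+I_{ij}I_{jk}\ge 0,\qquad I_{jk}+I_{ij}I_{ik}\ge 0$$ for every triangle $ijk\in F$. For $r:V\to(0,+\infty)$ give the edge $\{ij\}$ the length $$l_{ij}=\sqrt{r_i^2+r_j^2+2r_ir_jI_{ij}}\quad\text{(Euclidean case)},$$ $$l_{ij}=\cosh^{-1}\bigl(\cosh r_i\cosh r_j+I_{ij}\sinh r_i\sinh r_j\bigr)\quad\text{(hyperbolic case)}.$$ Such an $r$ is called a Euclidean (respectively hyperbolic) *inversive distance circle packing metric* if for every triangle $ijk\in F$ the three lengths $l_{ij},l_{ik},l_{jk}$ satisfy the strict triangle inequalities. For such an $r$ let $\theta_i^{jk}$ be the inner angle at $i$ of the Euclidean (respectively hyperbolic) triangle with side lengths $l_{ij},l_{ik},l_{jk}$, and let $$K_i=2\pi-\sum_{ijk\in F}\theta_i^{jk},$$ where the sum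 runs over all triangles having $i$ as a vertex. For $\alpha\in\mathbb R$ the *combinatorial $\alpha$-curvature* of $r$ is $$R_{\alpha,i}=\frac{K_i}{s_i^{\alpha}},\qquad s_i=r_i\ \text{(Euclidean case)},\qquad s_i=\tanh\frac{r_i}{2}\ \text{(hyperbolic case)}.$$ **Theorem 1.2.** Let $\alpha\in\mathbb R$ and let $\overline R:V\to\mathbb R$ be a given function. 1. If $\alpha\overline R\equiv 0$, then any two Euclidean inversive distance circle packing metrics with combinatorial $\alpha$-curvature $\overline R$ differ by a positive constant factor. If $\alpha\overline R\le 0$ and $\alpha\overline R\not\equiv 0$, then there is at most one Euclidean inversive distance circle packing metric with combinatorial $\alpha$-curvature $\overline R$. 2. If $\alpha\overline R\le 0$, then there is at most one hyperbolic inversive distance circle packing metric with combinatorial $\alpha$-curvature $\overline R$. -/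

import Mathlib

namespace InversiveDistance

/-- The triangles `ijk ∈ F` of a simplicial complex: its faces with three vertices. -/
def IsTriangle {V : Type*} (K : AbstractSimplicialComplex V) (t : Finset V) : Prop :=
  t ∈ K ∧ t.card = 3

/-- The edges `{ij} ∈ E` of a simplicial complex: its faces with two vertices. -/
def IsEdge {V : Type*} (K : AbstractSimplicialComplex V) (e : Finset V) : Prop :=
  e ∈ K ∧ e.card = 2

/-- The 1-skeleton of a simplicial complex, as a graph on the vertex set. -/
def skeleton {V : Type*} [DecidableEq V] (K : AbstractSimplicialComplex V) : SimpleGraph V :=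
  SimpleGraph.fromRel fun a b => IsEdge K {a, b}

/-- The link of the vertex `v`, as a graph: its vertices are the neighbours of `v`, and
`a`, `b` are joined when `vab` is a triangle. -/
def link {V : Type*} [DecidableEq V] (K : AbstractSimplicialComplex V) (v : V) :
    SimpleGraph {w : V // IsEdge K {v, w}} :=
  SimpleGraph.fromRel fun a b => IsTriangle K {v, a.1, b.1}

/-- A simplicial complex on a finite vertex set is a (triangulated) closed connected surface:
it is purely two-dimensional, every edge lies in exactly two triangles, the link of every vertex
is connected (so that it is one cycle, the link being a finite graph in which every vertex has
degree two by `edge_two`), and the 1-skeleton is connected. -/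
structure IsClosedSurface {V : Type*} [Fintype V] [DecidableEq V]
    (K : AbstractSimplicialComplex V) : Prop where
  /-- every simplex is a face of a triangle, and there are no simplices of dimension above two -/
  pure : ∀ s ∈ K, ∃ t, IsTriangle K t ∧ s ⊆ t
  /-- every edge lies in exactly two triangles -/
  edge_two : ∀ e, IsEdge K e → {t | IsTriangle K t ∧ e ⊆ t}.ncard = 2
  /-- vertex links are connected -/
  link_connected : ∀ v, (link K v).Connected
  /-- the surface is connected (in particular it is not empty) -/
  connected : (skeleton K).Connected

/-- The two background geometries. -/
inductive Background where
  | euclidean : Background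
  | hyperbolic : Background

/-- The length `l_ij` of the edge `{ij}` given by the radii `r` and the inversive distances `I`;
the inversive distance of the edge `{ij}` is `I {i, j}`. -/
noncomputable def edgeLength {V : Type*} [DecidableEq V] (g : Background) (I : Finset V → ℝ)
    (r : V → ℝ) (i j : V) : ℝ :=
  match g with
  | .euclidean => √(r i ^ 2 + r j ^ 2 + 2 * r i * r j * I {i, j})
  | .hyperbolic =>
      Real.arcosh (Real.cosh (r i) * Real.cosh (r j)
        + I {i, j} * (Real.sinh (r i) * Real.sinh (r j)))

/-- The inner angle at `i` of the Euclidean or hyperbolic triangle `ijk` with side lengths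
`l_ij`, `l_ik`, `l_jk`, by the law of cosines. -/
noncomputable def angle {V : Type*} [DecidableEq V] (g : Background) (I : Finset V → ℝ)
    (r : V → ℝ) (i j k : V) : ℝ :=
  let c := edgeLength g I r i j
  let b := edgeLength g I r i k
  let a := edgeLength g I r j k
  match g with
  | .euclidean => Real.arccos ((b ^ 2 + c ^ 2 - a ^ 2) / (2 * b * c))
  | .hyperbolic =>
      Real.arccos ((Real.cosh b * Real.cosh c - Real.cosh a) / (Real.sinh b * Real.sinh c))

/-- An inversive distance circle packing metric: positive radii for which the edge lengths of
every triangle satisfy the strict triangle inequalities (all three of them, since `i`, `j`, `k`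
run over all orderings of the vertices of a triangle). -/
def IsPackingMetric {V : Type*} [DecidableEq V] (g : Background) (K : AbstractSimplicialComplex V)
    (I : Finset V → ℝ) (r : V → ℝ) : Prop :=
  (∀ i, 0 < r i) ∧
  ∀ i j k, IsTriangle K {i, j, k} →
    edgeLength g I r j k < edgeLength g I r i j + edgeLength g I r i k

open Classical in
/-- The classical combinatorial curvature `K_i`: `2π` minus the sum of the inner angles at `i` of
all triangles with vertex `i`. The sum runs over ordered pairs `(j, k)` such that `ijk` is a
triangle; every triangle at `i` occurs exactly twice, as `ijk` and as `ikj`, with the same angle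
(see `angle_comm`), hence the factor `1 / 2`. -/
noncomputable def curvature {V : Type*} [Fintype V] [DecidableEq V] (g : Background)
    (K : AbstractSimplicialComplex V) (I : Finset V → ℝ) (r : V → ℝ) (i : V) : ℝ :=
  2 * Real.pi - (1 / 2 : ℝ) *
    ∑ j : V, ∑ k : V, if IsTriangle K {i, j, k} then angle g I r i j k else 0

/-- `s_i = r_i` in the Euclidean and `s_i = tanh (r_i / 2)` in the hyperbolic geometry. -/
noncomputable def scaleFactor {V : Type*} (g : Background) (r : V → ℝ) (i : V) : ℝ :=
  match g with
  | .euclidean => r i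
  | .hyperbolic => Real.tanh (r i / 2)

/-- The combinatorial `α`-curvature `R_{α,i} = K_i / s_i ^ α`. -/
noncomputable def alphaCurvature {V : Type*} [Fintype V] [DecidableEq V] (g : Background)
    (K : AbstractSimplicialComplex V) (I : Finset V → ℝ) (α : ℝ) (r : V → ℝ) (i : V) : ℝ :=
  curvature g K I r i / scaleFactor g r i ^ α

/-- The set of inversive distance circle packing metrics whose combinatorial `α`-curvature is the
prescribed function `R` on the vertices. -/
def metricsWithCurvature {V : Type*} [Fintype V] [DecidableEq V] (g : Background)
    (K : AbstractSimplicialComplex V) (I : Finset V → ℝ) (α : ℝ) (R : V → ℝ) : Set (V → ℝ) :=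
  {r | IsPackingMetric g K I r ∧ ∀ i, alphaCurvature g K I α r i = R i}

theorem edgeLength_comm {V : Type*} [DecidableEq V] (g : Background) (I : Finset V → ℝ)
    (r : V → ℝ) (i j : V) : edgeLength g I r i j = edgeLength g I r j i := by
  cases g <;> simp only [edgeLength, Finset.pair_comm i j] <;> congr 1 <;> ring

theorem angle_comm {V : Type*} [DecidableEq V] (g : Background) (I : Finset V → ℝ)
    (r : V → ℝ) (i j k : V) : angle g I r i j k = angle g I r i k j := by
  cases g <;> simp only [angle, edgeLength_comm _ I r k j] <;> congr 1 <;> ring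

end InversiveDistance

/-! The proof is a variational argument in logarithmic radii: `u_i = log s_i`, where `s_i` is the
scale factor, and `v_i` is the change of `u_i` between two metrics `r` and `s`. On a single
triangle, the Jacobian of the angles with respect to `u` is negative definite in hyperbolic
geometry. In Euclidean geometry it is negative semidefinite, with the constants as kernel. Convexity
would give rigidity at once if the segment from `r` to `s` in `u`-space stayed inside the packing
metrics, but it may leave them.

The segment is therefore followed through degenerate triangles. `Real.arccos` clamps its argument,
so the angles of a degenerate triangle lie in `{0, π}` and `∑ v_i θ_i` then takes only finitely many
values. Wherever the triangle is nondegenerate this pairing has negative derivative. A continuous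
function with this property that starts with negative derivative ends below its initial value
(`lt_of_deriv_neg_off_finite`, `angle_pairing_lt`). Nondegeneracy is needed only at `r`.

Definiteness is algebraic. Put `k_i = coth r_i`, or `1 / r_i` up to a common factor. The derivatives
of the angles are then governed by `height`, and at most one of the three heights is negative
(`height_pos_of_neg`). The determinant of the form factors into squares, gaps and `lengthJacobian`,
which is positive by the conditions on the inversive distances. In the Euclidean case this already
gives definiteness modulo constants. In the hyperbolic case one more principal minor must be shown
positive, by a deformation (`sum_triangleMinor_weight_pos`).

Summed over the triangles, this gives `∑ v_i (K_i(s) - K_i(r)) ≥ 0`, with equality only if every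
triangle keeps its shape. Since `K_i = R_i s_i ^ α` for both metrics and `α R ≤ 0`, the same sum is
also `≤ 0`. Hence all terms vanish (`sameShape_and_logChange_eq_zero`), and connectedness finishes
the Euclidean case. -/

namespace InversiveDistance

/-! ### Algebra of a triple of circles -/

/-- Half the partial derivative in `k₁` of the discriminant of a triple of circles, where `kᵢ` are
the curvatures of the circles and `Iᵢ` is the inversive distance of the other two circles. -/
def height (k₁ k₂ k₃ I₁ I₂ I₃ : ℝ) : ℝ :=
  k₁ * (1 - I₁ ^ 2) + k₂ * (I₃ + I₁ * I₂) + k₃ * (I₂ + I₁ * I₃)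

/-- The square of the normalized `sinh` of the distance of the centers of two circles. -/
def gap (k₂ k₃ I₁ : ℝ) : ℝ :=
  k₂ ^ 2 + k₃ ^ 2 + 2 * k₂ * k₃ * I₁ + I₁ ^ 2 - 1

/-- The discriminant of a hyperbolic triple of circles; it is positive exactly when the centers
span a nondegenerate triangle. -/
def discr (k₁ k₂ k₃ I₁ I₂ I₃ : ℝ) : ℝ :=
  k₁ * height k₁ k₂ k₃ I₁ I₂ I₃ + k₂ * height k₂ k₃ k₁ I₂ I₃ I₁ + k₃ * height k₃ k₁ k₂ I₃ I₁ I₂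
    + (I₁ ^ 2 + I₂ ^ 2 + I₃ ^ 2 + 2 * I₁ * I₂ * I₃ - 1)

/-- The normalized Jacobian determinant of the edge lengths with respect to the radii. -/
def lengthJacobian (k₁ k₂ k₃ I₁ I₂ I₃ : ℝ) : ℝ :=
  (k₃ + I₁ * k₂) * (k₁ + I₂ * k₃) * (k₂ + I₃ * k₁)
    + (k₂ + I₁ * k₃) * (k₃ + I₂ * k₁) * (k₁ + I₃ * k₂)

theorem height_swap (k₁ k₂ k₃ I₁ I₂ I₃ : ℝ) :
    height k₁ k₃ k₂ I₁ I₃ I₂ = height k₁ k₂ k₃ I₁ I₂ I₃ := by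
  unfold height; ring

/-- If neither height were positive, dropping their `k₃` terms and multiplying the two inequalities
would give `(I₃ + I₁ I₂)² ≤ (I₁² - 1)(I₂² - 1) = (I₁ I₂ - 1)² - (I₁ - I₂)²` with `I₁, I₂ ≥ 1`. This
contradicts `I₃ > -1`. Together with its mirror image, it shows that at most one height is negative.
-/
theorem height_pos_of_neg {k₁ k₂ k₃ I₁ I₂ I₃ : ℝ} (hk₁ : 0 < k₁) (hk₂ : 0 < k₂) (hk₃ : 0 ≤ k₃)
    (hI₁ : -1 < I₁) (hI₂ : -1 < I₂) (hI₃ : -1 < I₃) (h₁ : 0 ≤ I₁ + I₂ * I₃)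
    (h₂ : 0 ≤ I₂ + I₁ * I₃) (h₃ : 0 ≤ I₃ + I₁ * I₂) (h : height k₁ k₂ k₃ I₁ I₂ I₃ < 0) :
    0 < height k₂ k₃ k₁ I₂ I₃ I₁ := by
  by_contra! h'
  unfold height at h h'
  have a1 : k₂ * (I₃ + I₁ * I₂) < k₁ * (I₁ ^ 2 - 1) := by
    nlinarith [mul_nonneg hk₃ h₂]
  have a2 : k₁ * (I₃ + I₁ * I₂) ≤ k₂ * (I₂ ^ 2 - 1) := by
    nlinarith [mul_nonneg hk₃ h₁]
  have b1 : 0 < I₁ ^ 2 - 1 := by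
    by_contra! hc
    nlinarith [mul_nonneg hk₂.le h₃]
  have b2 : 0 ≤ I₂ ^ 2 - 1 := by
    by_contra! hc
    nlinarith [mul_nonneg hk₁.le h₃]
  have c1 : 1 < I₁ := by nlinarith
  have c2 : 1 ≤ I₂ := by nlinarith
  have d : 0 ≤ I₁ * I₂ - 1 := by nlinarith
  have d3 : I₁ * I₂ - 1 < I₃ + I₁ * I₂ := by linarith
  have e1 : (k₂ * (I₃ + I₁ * I₂)) * (k₁ * (I₃ + I₁ * I₂)) ≤
      (k₁ * (I₁ ^ 2 - 1)) * (k₂ * (I₂ ^ 2 - 1)) :=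
    mul_le_mul a1.le a2 (mul_nonneg hk₁.le h₃) (mul_nonneg hk₁.le b1.le)
  have e2 : (I₃ + I₁ * I₂) ^ 2 ≤ (I₁ ^ 2 - 1) * (I₂ ^ 2 - 1) := by
    refine le_of_mul_le_mul_left ?_ (mul_pos hk₁ hk₂)
    linarith
  nlinarith [sq_nonneg (I₁ - I₂), mul_self_lt_mul_self d d3]

theorem height_pos_of_neg' {k₁ k₂ k₃ I₁ I₂ I₃ : ℝ} (hk₁ : 0 < k₁) (hk₂ : 0 ≤ k₂) (hk₃ : 0 < k₃)
    (hI₁ : -1 < I₁) (hI₂ : -1 < I₂) (hI₃ : -1 < I₃) (h₁ : 0 ≤ I₁ + I₂ * I₃)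
    (h₂ : 0 ≤ I₂ + I₁ * I₃) (h₃ : 0 ≤ I₃ + I₁ * I₂) (h : height k₁ k₂ k₃ I₁ I₂ I₃ < 0) :
    0 < height k₃ k₁ k₂ I₃ I₁ I₂ := by
  rw [← height_swap] at h ⊢
  exact height_pos_of_neg hk₁ hk₃ hk₂ hI₁ hI₃ hI₂ (by linarith) h₃ h₂ h

/-- For `I₁ < 1` the gap is `(k₃ + k₂ I₁)² + (k₂² - 1)(1 - I₁²)`. Only one curvature has to exceed
`1`, which lets the other be deformed towards `0` later. -/
theorem gap_pos {k₂ k₃ I₁ : ℝ} (hk₂ : 1 < k₂) (hk₃ : 0 ≤ k₃) (hI₁ : -1 < I₁) :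
    0 < gap k₂ k₃ I₁ := by
  unfold gap
  rcases lt_or_ge I₁ 1 with h | h
  · have : 0 < (k₂ ^ 2 - 1) * (1 - I₁ ^ 2) := mul_pos (by nlinarith) (by nlinarith)
    nlinarith [sq_nonneg (k₃ + k₂ * I₁)]
  · have : 0 ≤ k₂ * k₃ * I₁ := by positivity
    nlinarith [sq_nonneg k₃]

theorem gap_comm (k₂ k₃ I₁ : ℝ) : gap k₂ k₃ I₁ = gap k₃ k₂ I₁ := by
  unfold gap; ring

/-- The Jacobian regroups so that its coefficients are exactly the quantities `1 + Iᵢ` and `Iᵢ + Iⱼ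
Iₖ` whose signs are assumed. -/
theorem lengthJacobian_pos {k₁ k₂ k₃ I₁ I₂ I₃ : ℝ} (hk₁ : 0 < k₁) (hk₂ : 0 < k₂) (hk₃ : 0 < k₃)
    (hI₁ : -1 < I₁) (hI₂ : -1 < I₂) (hI₃ : -1 < I₃) (h₁ : 0 ≤ I₁ + I₂ * I₃)
    (h₂ : 0 ≤ I₂ + I₁ * I₃) (h₃ : 0 ≤ I₃ + I₁ * I₂) :
    0 < lengthJacobian k₁ k₂ k₃ I₁ I₂ I₃ := by
  have key : lengthJacobian k₁ k₂ k₃ I₁ I₂ I₃ =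
      2 * (k₁ * k₂ * k₃) * ((1 + I₁) * (1 + I₂) * (1 + I₃))
        + (I₁ + I₂ * I₃) * k₁ * (k₂ - k₃) ^ 2 + (I₂ + I₁ * I₃) * k₂ * (k₁ - k₃) ^ 2
        + (I₃ + I₁ * I₂) * k₃ * (k₁ - k₂) ^ 2 := by
    unfold lengthJacobian; ring
  have e₁ : 0 < 1 + I₁ := by linarith
  have e₂ : 0 < 1 + I₂ := by linarith
  have e₃ : 0 < 1 + I₃ := by linarith
  rw [key]
  positivity

set_option maxHeartbeats 4000000 in
-- an identity of degree fifteen in six variables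
theorem height_gap_identity (k₁ k₂ k₃ I₁ I₂ I₃ : ℝ) :
    height k₁ k₂ k₃ I₁ I₂ I₃ ^ 2 *
        (height k₂ k₃ k₁ I₂ I₃ I₁ * (k₃ * k₁ + I₂) * gap k₁ k₂ I₃
          + height k₃ k₁ k₂ I₃ I₁ I₂ * (k₁ * k₂ + I₃) * gap k₃ k₁ I₂)
      + height k₂ k₃ k₁ I₂ I₃ I₁ ^ 2 *
        (height k₁ k₂ k₃ I₁ I₂ I₃ * (k₂ * k₃ + I₁) * gap k₁ k₂ I₃
          + height k₃ k₁ k₂ I₃ I₁ I₂ * (k₁ * k₂ + I₃) * gap k₂ k₃ I₁)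
      + height k₃ k₁ k₂ I₃ I₁ I₂ ^ 2 *
        (height k₂ k₃ k₁ I₂ I₃ I₁ * (k₃ * k₁ + I₂) * gap k₂ k₃ I₁
          + height k₁ k₂ k₃ I₁ I₂ I₃ * (k₂ * k₃ + I₁) * gap k₃ k₁ I₂)
      + 2 * height k₁ k₂ k₃ I₁ I₂ I₃ * height k₂ k₃ k₁ I₂ I₃ I₁ * height k₃ k₁ k₂ I₃ I₁ I₂ *
        ((k₂ * k₃ + I₁) * (k₃ * k₁ + I₂) * (k₁ * k₂ + I₃)
          - (k₁ ^ 2 - 1) * (k₂ ^ 2 - 1) * (k₃ ^ 2 - 1))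
    = discr k₁ k₂ k₃ I₁ I₂ I₃ ^ 2 * lengthJacobian k₁ k₂ k₃ I₁ I₂ I₃ := by
  unfold discr lengthJacobian height gap
  ring

end InversiveDistance

/-! ### Positivity of the quadratic form of a hyperbolic triangle -/

namespace InversiveDistance

/-- The quadratic form with diagonal entries `eᵢ (wⱼ aⱼ + wₖ aₖ)` and off-diagonal entries
`-wₖ eᵢ eⱼ`. -/
def triangleForm (w₁ w₂ w₃ a₁ a₂ a₃ e₁ e₂ e₃ z₁ z₂ z₃ : ℝ) : ℝ :=
  w₁ * (a₁ * (e₂ * z₂ ^ 2 + e₃ * z₃ ^ 2) - 2 * (e₂ * e₃) * (z₂ * z₃))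
    + w₂ * (a₂ * (e₃ * z₃ ^ 2 + e₁ * z₁ ^ 2) - 2 * (e₃ * e₁) * (z₃ * z₁))
    + w₃ * (a₃ * (e₁ * z₁ ^ 2 + e₂ * z₂ ^ 2) - 2 * (e₁ * e₂) * (z₁ * z₂))

/-- The normalized principal minor of `triangleForm` belonging to the indices `1` and `3`. -/
def triangleMinor (w₁ w₂ w₃ a₁ a₂ a₃ e₁ e₃ : ℝ) : ℝ :=
  w₁ * w₂ * (a₁ * a₂) + w₁ * w₃ * (a₁ * a₃) + w₂ * w₃ * (a₂ * a₃) + w₂ ^ 2 * (a₂ ^ 2 - e₃ * e₁)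

/-- The normalized determinant of `triangleForm`. -/
def triangleDet (w₁ w₂ w₃ a₁ a₂ a₃ e₁ e₂ e₃ : ℝ) : ℝ :=
  w₁ ^ 2 * (a₁ ^ 2 - e₂ * e₃) * (w₂ * a₂ + w₃ * a₃)
    + w₂ ^ 2 * (a₂ ^ 2 - e₃ * e₁) * (w₁ * a₁ + w₃ * a₃)
    + w₃ ^ 2 * (a₃ ^ 2 - e₁ * e₂) * (w₁ * a₁ + w₂ * a₂)
    + 2 * w₁ * w₂ * w₃ * (a₁ * a₂ * a₃ - e₁ * e₂ * e₃)

theorem triangleForm_rotate (w₁ w₂ w₃ a₁ a₂ a₃ e₁ e₂ e₃ z₁ z₂ z₃ : ℝ) :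
    triangleForm w₂ w₃ w₁ a₂ a₃ a₁ e₂ e₃ e₁ z₂ z₃ z₁ =
      triangleForm w₁ w₂ w₃ a₁ a₂ a₃ e₁ e₂ e₃ z₁ z₂ z₃ := by
  unfold triangleForm; ring

/-- Desnanot–Jacobi identity for the symmetric matrix of `triangleForm`. With a positive determinant
and a positive third diagonal entry, the two minors containing the third index have the same sign.
-/
theorem triangleMinor_mul (w₁ w₂ w₃ a₁ a₂ a₃ e₁ e₂ e₃ : ℝ) :
    triangleMinor w₁ w₂ w₃ a₁ a₂ a₃ e₁ e₃ * triangleMinor w₂ w₁ w₃ a₂ a₁ a₃ e₂ e₃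
    = (w₁ * a₁ + w₂ * a₂) * triangleDet w₁ w₂ w₃ a₁ a₂ a₃ e₁ e₂ e₃
      + e₁ * e₂ * (e₃ * w₁ * w₂ + w₃ * (w₁ * a₁ + w₂ * a₂)) ^ 2 := by
  unfold triangleMinor triangleDet; ring

/-- Sylvester's criterion along the index sets `{3}`, `{1, 3}`, `{1, 2, 3}`, proved by completing
the square in `z₃` and then in `z₁`. -/
theorem triangleForm_pos {w₁ w₂ w₃ a₁ a₂ a₃ e₁ e₂ e₃ : ℝ} (he₁ : 0 < e₁) (he₂ : 0 < e₂)
    (he₃ : 0 < e₃) (hb : 0 < w₁ * a₁ + w₂ * a₂)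
    (hm : 0 < triangleMinor w₁ w₂ w₃ a₁ a₂ a₃ e₁ e₃)
    (hd : 0 < triangleDet w₁ w₂ w₃ a₁ a₂ a₃ e₁ e₂ e₃) {z₁ z₂ z₃ : ℝ}
    (hz : ¬ (z₁ = 0 ∧ z₂ = 0 ∧ z₃ = 0)) :
    0 < triangleForm w₁ w₂ w₃ a₁ a₂ a₃ e₁ e₂ e₃ z₁ z₂ z₃ := by
  have hmm := triangleMinor_mul w₁ w₂ w₃ a₁ a₂ a₃ e₁ e₂ e₃
  set m := triangleMinor w₁ w₂ w₃ a₁ a₂ a₃ e₁ e₃ with hm_def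
  set m' := triangleMinor w₂ w₁ w₃ a₂ a₁ a₃ e₂ e₃ with hm'_def
  set d := triangleDet w₁ w₂ w₃ a₁ a₂ a₃ e₁ e₂ e₃
  set b := w₁ * a₁ + w₂ * a₂ with hb_def
  set t := e₃ * w₁ * w₂ + w₃ * b with ht
  have key : b * triangleForm w₁ w₂ w₃ a₁ a₂ a₃ e₁ e₂ e₃ z₁ z₂ z₃ =
      e₃ * (b * z₃ - w₁ * e₂ * z₂ - w₂ * e₁ * z₁) ^ 2
        + (e₁ * m * z₁ ^ 2 + e₂ * m' * z₂ ^ 2 - 2 * (e₁ * e₂) * t * (z₁ * z₂)) := by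
    rw [ht, hm_def, hm'_def, hb_def]
    unfold triangleForm triangleMinor; ring
  have key2 : (e₁ * m) * (e₁ * m * z₁ ^ 2 + e₂ * m' * z₂ ^ 2 - 2 * (e₁ * e₂) * t * (z₁ * z₂)) =
      (e₁ * m * z₁ - e₁ * e₂ * t * z₂) ^ 2 + e₁ * e₂ * (b * d) * z₂ ^ 2 := by
    linear_combination e₁ * e₂ * z₂ ^ 2 * hmm
  have hem : 0 < e₁ * m := mul_pos he₁ hm
  refine pos_of_mul_pos_right (a := b) ?_ hb.le
  rw [key]
  by_cases h2 : z₂ = 0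
  · subst h2
    by_cases h1 : z₁ = 0
    · subst h1
      have : z₃ ≠ 0 := fun h => hz ⟨rfl, rfl, h⟩
      have : 0 < e₃ * (b * z₃) ^ 2 := by positivity
      simpa using this
    · have : 0 < e₁ * m * z₁ ^ 2 := by positivity
      have : 0 ≤ e₃ * (b * z₃ - w₁ * e₂ * 0 - w₂ * e₁ * z₁) ^ 2 := by positivity
      linarith
  · have h3 : 0 < e₁ * m * z₁ ^ 2 + e₂ * m' * z₂ ^ 2 - 2 * (e₁ * e₂) * t * (z₁ * z₂) := by
      refine pos_of_mul_pos_right (a := e₁ * m) ?_ hem.le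
      rw [key2]
      positivity
    positivity

/-- The normalized derivative of an angle of a hyperbolic triangle with respect to the
logarithmic radius at another vertex. -/
noncomputable def weight (k₁ k₂ k₃ I₁ I₂ I₃ : ℝ) : ℝ :=
  height k₁ k₂ k₃ I₁ I₂ I₃ / gap k₂ k₃ I₁

theorem gap_eq (k₂ k₃ I₁ : ℝ) :
    gap k₂ k₃ I₁ = (k₂ * k₃ + I₁) ^ 2 - (k₂ ^ 2 - 1) * (k₃ ^ 2 - 1) := by
  unfold gap; ring

/-- By `gap_eq`, each factor `aᵢ² - eⱼ eₖ` of the determinant is a gap and cancels a denominator of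
the weights. After multiplication by the three gaps, `height_gap_identity` turns the determinant
into `discr² * lengthJacobian`. -/
theorem triangleDet_weight_pos {k₁ k₂ k₃ I₁ I₂ I₃ : ℝ} (hN₁ : 0 < gap k₂ k₃ I₁)
    (hN₂ : 0 < gap k₃ k₁ I₂) (hN₃ : 0 < gap k₁ k₂ I₃) (hQ : discr k₁ k₂ k₃ I₁ I₂ I₃ ≠ 0)
    (hJ : 0 < lengthJacobian k₁ k₂ k₃ I₁ I₂ I₃) :
    0 < triangleDet (weight k₁ k₂ k₃ I₁ I₂ I₃) (weight k₂ k₃ k₁ I₂ I₃ I₁)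
      (weight k₃ k₁ k₂ I₃ I₁ I₂) (k₂ * k₃ + I₁) (k₃ * k₁ + I₂) (k₁ * k₂ + I₃)
      (k₁ ^ 2 - 1) (k₂ ^ 2 - 1) (k₃ ^ 2 - 1) := by
  have key := height_gap_identity k₁ k₂ k₃ I₁ I₂ I₃
  unfold triangleDet weight
  rw [← gap_eq, ← gap_eq, ← gap_eq]
  set N₁ := gap k₂ k₃ I₁
  set N₂ := gap k₃ k₁ I₂
  set N₃ := gap k₁ k₂ I₃
  refine pos_of_mul_pos_right (a := N₁ * N₂ * N₃) ?_ (by positivity)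
  have : 0 < discr k₁ k₂ k₃ I₁ I₂ I₃ ^ 2 * lengthJacobian k₁ k₂ k₃ I₁ I₂ I₃ := by positivity
  rw [← key] at this
  refine this.trans_eq ?_
  field_simp
  ring

/-- The two normalized principal minors containing the third index have the same sign when the
discriminant is positive; this also holds when the third curvature is at most `1`. -/
theorem triangleMinor_weight_mul_pos {k₁ k₂ k₃ I₁ I₂ I₃ : ℝ} (hk₁ : 1 < k₁) (hk₂ : 1 < k₂)
    (hk₃ : 0 < k₃) (hI₁ : -1 < I₁) (hI₂ : -1 < I₂) (hI₃ : -1 < I₃) (h₁ : 0 ≤ I₁ + I₂ * I₃)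
    (h₂ : 0 ≤ I₂ + I₁ * I₃) (h₃ : 0 ≤ I₃ + I₁ * I₂) (hQ : 0 < discr k₁ k₂ k₃ I₁ I₂ I₃)
    (hb : 0 < weight k₁ k₂ k₃ I₁ I₂ I₃ * (k₂ * k₃ + I₁)
      + weight k₂ k₃ k₁ I₂ I₃ I₁ * (k₃ * k₁ + I₂)) :
    0 < triangleMinor (weight k₁ k₂ k₃ I₁ I₂ I₃) (weight k₂ k₃ k₁ I₂ I₃ I₁)
        (weight k₃ k₁ k₂ I₃ I₁ I₂) (k₂ * k₃ + I₁) (k₃ * k₁ + I₂) (k₁ * k₂ + I₃)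
        (k₁ ^ 2 - 1) (k₃ ^ 2 - 1) *
      triangleMinor (weight k₂ k₃ k₁ I₂ I₃ I₁) (weight k₁ k₂ k₃ I₁ I₂ I₃)
        (weight k₃ k₁ k₂ I₃ I₁ I₂) (k₃ * k₁ + I₂) (k₂ * k₃ + I₁) (k₁ * k₂ + I₃)
        (k₂ ^ 2 - 1) (k₃ ^ 2 - 1) := by
  have hd := triangleDet_weight_pos (gap_pos hk₂ hk₃.le hI₁)
    (by rw [gap_comm]; exact gap_pos hk₁ hk₃.le hI₂) (gap_pos hk₁ (by linarith) hI₃) hQ.ne'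
    (lengthJacobian_pos (by linarith) (by linarith) hk₃ hI₁ hI₂ hI₃ h₁ h₂ h₃)
  rw [triangleMinor_mul]
  have e₁ : 0 < k₁ ^ 2 - 1 := by nlinarith
  have e₂ : 0 < k₂ ^ 2 - 1 := by nlinarith
  have := mul_pos hb hd
  positivity

/-- Deformation argument: lower the third curvature to the value `s` at which its height is zero.
The sum of the minors cannot vanish on the way, because the two have a positive product. At `s` the
third weight is zero and the sum is visibly positive. -/
theorem sum_triangleMinor_weight_pos {k₁ k₂ k₃ I₁ I₂ I₃ : ℝ} (hk₁ : 1 < k₁) (hk₂ : 1 < k₂)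
    (hk₃ : 0 < k₃) (hI₁ : -1 < I₁) (hI₂ : -1 < I₂) (hI₃ : -1 < I₃) (h₁ : 0 ≤ I₁ + I₂ * I₃)
    (h₂ : 0 ≤ I₂ + I₁ * I₃) (h₃ : 0 ≤ I₃ + I₁ * I₂) (hQ : 0 < discr k₁ k₂ k₃ I₁ I₂ I₃)
    (hneg : height k₃ k₁ k₂ I₃ I₁ I₂ < 0) :
    0 < triangleMinor (weight k₁ k₂ k₃ I₁ I₂ I₃) (weight k₂ k₃ k₁ I₂ I₃ I₁)
        (weight k₃ k₁ k₂ I₃ I₁ I₂) (k₂ * k₃ + I₁) (k₃ * k₁ + I₂) (k₁ * k₂ + I₃)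
        (k₁ ^ 2 - 1) (k₃ ^ 2 - 1) +
      triangleMinor (weight k₂ k₃ k₁ I₂ I₃ I₁) (weight k₁ k₂ k₃ I₁ I₂ I₃)
        (weight k₃ k₁ k₂ I₃ I₁ I₂) (k₃ * k₁ + I₂) (k₂ * k₃ + I₁) (k₁ * k₂ + I₃)
        (k₂ ^ 2 - 1) (k₃ ^ 2 - 1) := by
  have hk₁0 : 0 < k₁ := by linarith
  have hk₂0 : 0 < k₂ := by linarith
  have hc : 0 ≤ k₁ * (I₂ + I₁ * I₃) + k₂ * (I₁ + I₂ * I₃) :=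
    add_nonneg (mul_nonneg hk₁0.le h₂) (mul_nonneg hk₂0.le h₁)
  have hI₃' : 1 < I₃ := by
    unfold height at hneg
    by_contra! h
    have : 0 ≤ k₃ * (1 - I₃ ^ 2) := mul_nonneg hk₃.le (by nlinarith)
    linarith
  have hI₃'' : 0 < I₃ ^ 2 - 1 := by nlinarith
  -- decrease the third curvature until the third height vanishes
  obtain ⟨s, hs⟩ : ∃ s, s = (k₁ * (I₂ + I₁ * I₃) + k₂ * (I₁ + I₂ * I₃)) / (I₃ ^ 2 - 1) := ⟨_, rfl⟩
  have hs0 : 0 ≤ s := hs ▸ div_nonneg hc hI₃''.le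
  have hheight : ∀ x, height x k₁ k₂ I₃ I₁ I₂ = (s - x) * (I₃ ^ 2 - 1) := by
    intro x
    rw [hs]; unfold height; field_simp; ring
  have hsk : s < k₃ := by
    rw [hheight] at hneg
    nlinarith
  have ha₁ : 0 ≤ k₂ * s + I₁ := by
    have e : (I₃ ^ 2 - 1) * (k₂ * s + I₁) = k₁ * k₂ * (I₂ + I₁ * I₃)
        + (k₂ ^ 2 - 1) * (I₁ + I₂ * I₃) + I₃ * (I₂ + I₁ * I₃) := by
      rw [hs]; field_simp; ring
    refine nonneg_of_mul_nonneg_right (a := I₃ ^ 2 - 1) ?_ hI₃''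
    have : 0 ≤ k₂ ^ 2 - 1 := by nlinarith
    rw [e]
    positivity
  have ha₂ : 0 ≤ s * k₁ + I₂ := by
    have e : (I₃ ^ 2 - 1) * (s * k₁ + I₂) = k₁ * k₂ * (I₁ + I₂ * I₃)
        + (k₁ ^ 2 - 1) * (I₂ + I₁ * I₃) + I₃ * (I₁ + I₂ * I₃) := by
      rw [hs]; field_simp; ring
    refine nonneg_of_mul_nonneg_right (a := I₃ ^ 2 - 1) ?_ hI₃''
    have : 0 ≤ k₁ ^ 2 - 1 := by nlinarith
    rw [e]
    positivity
  have hN₁ : ∀ x ∈ Set.Icc s k₃, 0 < gap k₂ x I₁ := fun x hx => gap_pos hk₂ (hs0.trans hx.1) hI₁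
  have hN₂ : ∀ x ∈ Set.Icc s k₃, 0 < gap x k₁ I₂ := fun x hx => by
    rw [gap_comm]; exact gap_pos hk₁ (hs0.trans hx.1) hI₂
  have hN₃ : 0 < gap k₁ k₂ I₃ := gap_pos hk₁ hk₂0.le hI₃
  -- The derivative of the discriminant in the third curvature is twice the third height. That
  -- height is nonpositive on `[s, k₃]`, so lowering the curvature does not decrease the
  -- discriminant.
  have hdiscr : ∀ x ∈ Set.Icc s k₃, 0 < discr k₁ k₂ x I₁ I₂ I₃ := by
    intro x hx
    have : discr k₁ k₂ x I₁ I₂ I₃ = discr k₁ k₂ k₃ I₁ I₂ I₃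
        - (k₃ - x) * (height k₃ k₁ k₂ I₃ I₁ I₂ + height x k₁ k₂ I₃ I₁ I₂) := by
      unfold discr height; ring
    rw [this]
    have h1 : height x k₁ k₂ I₃ I₁ I₂ ≤ 0 := by
      rw [hheight]; exact mul_nonpos_of_nonpos_of_nonneg (by linarith [hx.1]) hI₃''.le
    have := mul_nonneg (sub_nonneg.2 hx.2)
      (show 0 ≤ -(height k₃ k₁ k₂ I₃ I₁ I₂ + height x k₁ k₂ I₃ I₁ I₂) by linarith)
    linarith
  have hh₁' : ∀ x ∈ Set.Ioc s k₃, 0 < height k₁ k₂ x I₁ I₂ I₃ := fun x hx =>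
    height_pos_of_neg (hs0.trans_lt hx.1) hk₁0 hk₂0.le hI₃ hI₁ hI₂ (by linarith) (by linarith)
      (by linarith) (by rw [hheight]; exact mul_neg_of_neg_of_pos (by linarith [hx.1]) hI₃'')
  have hh₂' : ∀ x ∈ Set.Ioc s k₃, 0 < height k₂ x k₁ I₂ I₃ I₁ := fun x hx =>
    height_pos_of_neg' (hs0.trans_lt hx.1) hk₁0.le hk₂0 hI₃ hI₁ hI₂ (by linarith) (by linarith)
      (by linarith) (by rw [hheight]; exact mul_neg_of_neg_of_pos (by linarith [hx.1]) hI₃'')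
  have hcont₁ : Continuous fun x => height k₁ k₂ x I₁ I₂ I₃ := by unfold height; fun_prop
  have hcont₂ : Continuous fun x => height k₂ x k₁ I₂ I₃ I₁ := by unfold height; fun_prop
  have hcont₃ : Continuous fun x => height x k₁ k₂ I₃ I₁ I₂ := by unfold height; fun_prop
  have hcontN₁ : Continuous fun x => gap k₂ x I₁ := by unfold gap; fun_prop
  have hcontN₂ : Continuous fun x => gap x k₁ I₂ := by unfold gap; fun_prop
  have hev : ∀ᶠ x in nhdsWithin s (Set.Ioi s), x ∈ Set.Ioc s k₃ := Ioc_mem_nhdsGT hsk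
  have hh₁ : 0 ≤ height k₁ k₂ s I₁ I₂ I₃ :=
    ge_of_tendsto hcont₁.continuousWithinAt (hev.mono fun x hx => (hh₁' x hx).le)
  have hh₂ : 0 ≤ height k₂ s k₁ I₂ I₃ I₁ :=
    ge_of_tendsto hcont₂.continuousWithinAt (hev.mono fun x hx => (hh₂' x hx).le)
  set f : ℝ → ℝ := fun x =>
      triangleMinor (weight k₁ k₂ x I₁ I₂ I₃) (weight k₂ x k₁ I₂ I₃ I₁)
        (weight x k₁ k₂ I₃ I₁ I₂) (k₂ * x + I₁) (x * k₁ + I₂) (k₁ * k₂ + I₃)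
        (k₁ ^ 2 - 1) (x ^ 2 - 1) +
      triangleMinor (weight k₂ x k₁ I₂ I₃ I₁) (weight k₁ k₂ x I₁ I₂ I₃)
        (weight x k₁ k₂ I₃ I₁ I₂) (x * k₁ + I₂) (k₂ * x + I₁) (k₁ * k₂ + I₃)
        (k₂ ^ 2 - 1) (x ^ 2 - 1) with hf
  have hfs : 0 < f s := by
    have hN₁s := hN₁ s ⟨le_rfl, hsk.le⟩
    have hN₂s := hN₂ s ⟨le_rfl, hsk.le⟩
    have hw₁ : 0 ≤ weight k₁ k₂ s I₁ I₂ I₃ := div_nonneg hh₁ hN₁s.le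
    have hw₂ : 0 ≤ weight k₂ s k₁ I₂ I₃ I₁ := div_nonneg hh₂ hN₂s.le
    have hw₃ : weight s k₁ k₂ I₃ I₁ I₂ = 0 := by simp [weight, hheight]
    have hne : 0 < weight k₁ k₂ s I₁ I₂ I₃ ^ 2 * gap k₂ s I₁
        + weight k₂ s k₁ I₂ I₃ I₁ ^ 2 * gap s k₁ I₂ := by
      rcases hw₁.lt_or_eq with h | h
      · positivity
      rcases hw₂.lt_or_eq with h' | h'
      · positivity
      exfalso
      have e₁ : height k₁ k₂ s I₁ I₂ I₃ = 0 := by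
        simpa [weight, hN₁s.ne'] using h.symm
      have e₂ : height k₂ s k₁ I₂ I₃ I₁ = 0 := by
        simpa [weight, hN₂s.ne'] using h'.symm
      have e₃ : height s k₁ k₂ I₃ I₁ I₂ = 0 := by simp [hheight]
      have hQs := hdiscr s ⟨le_rfl, hsk.le⟩
      -- The heights are the adjugate of the symmetric matrix with diagonal `-1` and off-diagonal
      -- entries `Iᵢ`, applied to the curvatures. This is the first row of `M * adj M = det M`. If
      -- all heights vanish, so does `det M`, and with it the discriminant.
      have hGk : k₁ * (I₁ ^ 2 + I₂ ^ 2 + I₃ ^ 2 + 2 * I₁ * I₂ * I₃ - 1) =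
          -height k₁ k₂ s I₁ I₂ I₃ + I₃ * height k₂ s k₁ I₂ I₃ I₁
            + I₂ * height s k₁ k₂ I₃ I₁ I₂ := by
        unfold height; ring
      rw [e₁, e₂, e₃] at hGk
      have hG : I₁ ^ 2 + I₂ ^ 2 + I₃ ^ 2 + 2 * I₁ * I₂ * I₃ - 1 = 0 := by
        have : k₁ * (I₁ ^ 2 + I₂ ^ 2 + I₃ ^ 2 + 2 * I₁ * I₂ * I₃ - 1) = 0 := by linarith
        exact (mul_eq_zero.1 this).resolve_left hk₁0.ne'
      rw [discr, e₁, e₂, e₃, hG] at hQs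
      simp at hQs
    have : f s = 2 * (weight k₁ k₂ s I₁ I₂ I₃ * weight k₂ s k₁ I₂ I₃ I₁
          * ((k₂ * s + I₁) * (s * k₁ + I₂)))
        + (weight k₁ k₂ s I₁ I₂ I₃ ^ 2 * gap k₂ s I₁
          + weight k₂ s k₁ I₂ I₃ I₁ ^ 2 * gap s k₁ I₂) := by
      rw [hf]
      simp only [triangleMinor, hw₃, gap_eq]
      ring
    rw [this]
    positivity
  have hfne : ∀ x ∈ Set.Icc s k₃, f x ≠ 0 := by
    intro x hx
    rcases hx.1.eq_or_lt with rfl | hlt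
    · exact hfs.ne'
    have hw₁ : 0 < weight k₁ k₂ x I₁ I₂ I₃ := div_pos (hh₁' x ⟨hlt, hx.2⟩) (hN₁ x hx)
    have hw₂ : 0 < weight k₂ x k₁ I₂ I₃ I₁ := div_pos (hh₂' x ⟨hlt, hx.2⟩) (hN₂ x hx)
    have ha₁' : 0 < k₂ * x + I₁ := by nlinarith
    have ha₂' : 0 < x * k₁ + I₂ := by nlinarith
    have hmul := triangleMinor_weight_mul_pos hk₁ hk₂ (hs0.trans_lt hlt) hI₁ hI₂ hI₃ h₁ h₂ h₃
      (hdiscr x hx) (by positivity)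
    intro h0
    simp only [hf] at h0
    rw [add_eq_zero_iff_eq_neg.1 h0, neg_mul] at hmul
    exact (neg_pos.1 hmul).not_ge (mul_self_nonneg _)
  have hfcont : ContinuousOn f (Set.Icc s k₃) := by
    have c₁ : ContinuousOn (fun x => weight k₁ k₂ x I₁ I₂ I₃) (Set.Icc s k₃) :=
      hcont₁.continuousOn.div hcontN₁.continuousOn fun x hx => (hN₁ x hx).ne'
    have c₂ : ContinuousOn (fun x => weight k₂ x k₁ I₂ I₃ I₁) (Set.Icc s k₃) :=
      hcont₂.continuousOn.div hcontN₂.continuousOn fun x hx => (hN₂ x hx).ne'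
    have c₃ : ContinuousOn (fun x => weight x k₁ k₂ I₃ I₁ I₂) (Set.Icc s k₃) :=
      hcont₃.continuousOn.div continuousOn_const fun x _ => hN₃.ne'
    simp only [hf, triangleMinor]
    fun_prop
  by_contra! hle
  obtain ⟨x, hx, hx0⟩ := intermediate_value_Icc' hsk.le hfcont ⟨hle, hfs.le⟩
  exact hfne x hx hx0

/-- The vertices are labelled so that only the third height can be negative. The third diagonal
entry is then positive, since the determinant would vanish if both `w₁` and `w₂` did. -/
theorem triangleForm_weight_pos_aux {k₁ k₂ k₃ I₁ I₂ I₃ : ℝ} (hk₁ : 1 < k₁) (hk₂ : 1 < k₂)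
    (hk₃ : 1 < k₃) (hI₁ : -1 < I₁) (hI₂ : -1 < I₂) (hI₃ : -1 < I₃) (h₁ : 0 ≤ I₁ + I₂ * I₃)
    (h₂ : 0 ≤ I₂ + I₁ * I₃) (h₃ : 0 ≤ I₃ + I₁ * I₂) (hQ : 0 < discr k₁ k₂ k₃ I₁ I₂ I₃)
    (hh₁ : 0 ≤ height k₁ k₂ k₃ I₁ I₂ I₃) (hh₂ : 0 ≤ height k₂ k₃ k₁ I₂ I₃ I₁)
    {z₁ z₂ z₃ : ℝ} (hz : ¬ (z₁ = 0 ∧ z₂ = 0 ∧ z₃ = 0)) :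
    0 < triangleForm (weight k₁ k₂ k₃ I₁ I₂ I₃) (weight k₂ k₃ k₁ I₂ I₃ I₁)
        (weight k₃ k₁ k₂ I₃ I₁ I₂) (k₂ * k₃ + I₁) (k₃ * k₁ + I₂) (k₁ * k₂ + I₃)
        (k₁ ^ 2 - 1) (k₂ ^ 2 - 1) (k₃ ^ 2 - 1) z₁ z₂ z₃ := by
  have hN₁ := gap_pos hk₂ (by linarith : 0 ≤ k₃) hI₁
  have hN₂ := gap_pos hk₃ (by linarith : 0 ≤ k₁) hI₂
  have hN₃ := gap_pos hk₁ (by linarith : 0 ≤ k₂) hI₃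
  have hd := triangleDet_weight_pos hN₁ hN₂ hN₃ hQ.ne'
    (lengthJacobian_pos (by linarith) (by linarith) (by linarith) hI₁ hI₂ hI₃ h₁ h₂ h₃)
  have hw₁ : 0 ≤ weight k₁ k₂ k₃ I₁ I₂ I₃ := div_nonneg hh₁ hN₁.le
  have hw₂ : 0 ≤ weight k₂ k₃ k₁ I₂ I₃ I₁ := div_nonneg hh₂ hN₂.le
  have ha₁ : 0 < k₂ * k₃ + I₁ := by nlinarith
  have ha₂ : 0 < k₃ * k₁ + I₂ := by nlinarith
  have ha₃ : 0 < k₁ * k₂ + I₃ := by nlinarith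
  have hb : 0 < weight k₁ k₂ k₃ I₁ I₂ I₃ * (k₂ * k₃ + I₁)
      + weight k₂ k₃ k₁ I₂ I₃ I₁ * (k₃ * k₁ + I₂) := by
    rcases hw₁.lt_or_eq with h | h
    · positivity
    rcases hw₂.lt_or_eq with h' | h'
    · positivity
    rw [triangleDet, ← h, ← h'] at hd
    simp at hd
  have hmul := triangleMinor_weight_mul_pos hk₁ hk₂ (by linarith) hI₁ hI₂ hI₃ h₁ h₂ h₃ hQ hb
  refine triangleForm_pos (by nlinarith) (by nlinarith) (by nlinarith) hb ?_ hd hz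
  rcases lt_or_ge (height k₃ k₁ k₂ I₃ I₁ I₂) 0 with h | h
  · have hsum := sum_triangleMinor_weight_pos hk₁ hk₂ (by linarith) hI₁ hI₂ hI₃ h₁ h₂ h₃ hQ h
    by_contra! hle
    nlinarith
  · have hw₃ : 0 ≤ weight k₃ k₁ k₂ I₃ I₁ I₂ := div_nonneg h hN₃.le
    refine (left_ne_zero_of_mul hmul.ne').symm.lt_of_le ?_
    rw [triangleMinor, ← gap_eq]
    positivity

theorem discr_rotate (k₁ k₂ k₃ I₁ I₂ I₃ : ℝ) :
    discr k₂ k₃ k₁ I₂ I₃ I₁ = discr k₁ k₂ k₃ I₁ I₂ I₃ := by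
  unfold discr; ring

theorem triangleForm_weight_pos {k₁ k₂ k₃ I₁ I₂ I₃ : ℝ} (hk₁ : 1 < k₁) (hk₂ : 1 < k₂)
    (hk₃ : 1 < k₃) (hI₁ : -1 < I₁) (hI₂ : -1 < I₂) (hI₃ : -1 < I₃) (h₁ : 0 ≤ I₁ + I₂ * I₃)
    (h₂ : 0 ≤ I₂ + I₁ * I₃) (h₃ : 0 ≤ I₃ + I₁ * I₂) (hQ : 0 < discr k₁ k₂ k₃ I₁ I₂ I₃)
    {z₁ z₂ z₃ : ℝ} (hz : ¬ (z₁ = 0 ∧ z₂ = 0 ∧ z₃ = 0)) :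
    0 < triangleForm (weight k₁ k₂ k₃ I₁ I₂ I₃) (weight k₂ k₃ k₁ I₂ I₃ I₁)
        (weight k₃ k₁ k₂ I₃ I₁ I₂) (k₂ * k₃ + I₁) (k₃ * k₁ + I₂) (k₁ * k₂ + I₃)
        (k₁ ^ 2 - 1) (k₂ ^ 2 - 1) (k₃ ^ 2 - 1) z₁ z₂ z₃ := by
  have hk₁0 : 0 < k₁ := by linarith
  have hk₂0 : 0 < k₂ := by linarith
  have hk₃0 : 0 < k₃ := by linarith
  rcases lt_or_ge (height k₁ k₂ k₃ I₁ I₂ I₃) 0 with n₁ | n₁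
  · rw [← triangleForm_rotate]
    exact triangleForm_weight_pos_aux hk₂ hk₃ hk₁ hI₂ hI₃ hI₁ (by linarith) (by linarith)
      (by linarith) (by rwa [discr_rotate])
      (height_pos_of_neg hk₁0 hk₂0 hk₃0.le hI₁ hI₂ hI₃ h₁ h₂ h₃ n₁).le
      (height_pos_of_neg' hk₁0 hk₂0.le hk₃0 hI₁ hI₂ hI₃ h₁ h₂ h₃ n₁).le (by tauto)
  rcases lt_or_ge (height k₂ k₃ k₁ I₂ I₃ I₁) 0 with n₂ | n₂
  · rw [← triangleForm_rotate, ← triangleForm_rotate]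
    exact triangleForm_weight_pos_aux hk₃ hk₁ hk₂ hI₃ hI₁ hI₂ (by linarith) (by linarith)
      (by linarith) (by rwa [discr_rotate, discr_rotate])
      (height_pos_of_neg hk₂0 hk₃0 hk₁0.le hI₂ hI₃ hI₁ (by linarith) (by linarith)
        (by linarith) n₂).le n₁ (by tauto)
  exact triangleForm_weight_pos_aux hk₁ hk₂ hk₃ hI₁ hI₂ hI₃ h₁ h₂ h₃ hQ n₁ n₂ hz

end InversiveDistance

namespace InversiveDistance
open Set Filter Topology

/-! ### The monotonicity argument -/

/-- If `f` returned to its initial height, it would cross some level `c` outside `S` for a last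
time. At that point its derivative is negative, so `f` drops below `c` again, a contradiction. -/
theorem lt_of_deriv_neg_off_finite {f f' : ℝ → ℝ} {S : Set ℝ} (hS : S.Finite) {a b : ℝ}
    (hab : a < b) (hf : ContinuousOn f (Icc a b))
    (hd : ∀ t ∈ Icc a b, f t ∈ S ∨ (HasDerivAt f (f' t) t ∧ f' t < 0))
    (ha : HasDerivAt f (f' a) a ∧ f' a < 0) : f b < f a := by
  by_contra! hle
  have hdec : ∀ t, HasDerivAt f (f' t) t → f' t < 0 → ∀ᶠ x in 𝓝[>] t, f x < f t := by
    intro t ht hneg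
    have := (hasDerivAt_iff_tendsto_slope.1 ht).eventually (gt_mem_nhds hneg)
    filter_upwards [this.filter_mono (nhdsWithin_mono t fun x hx => ne_of_gt hx),
      self_mem_nhdsWithin] with x hx hxt
    rw [slope_def_field, div_neg_iff] at hx
    have : t < x := hxt
    rcases hx with h | h <;> linarith
  obtain ⟨s, hs, hsab⟩ := ((hdec a ha.1 ha.2).and (Ioc_mem_nhdsGT hab)).exists
  -- The initial negative derivative supplies `s` with `f s < f a ≤ f b`, hence a whole interval of
  -- levels, and the finite set `S` cannot exhaust it.
  obtain ⟨c, hc, hcS⟩ := ((Ioo_infinite (hs.trans_le hle)).sdiff hS).nonempty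
  set T := {x ∈ Icc s b | f x ≤ c} with hT
  have hsub : Icc s b ⊆ Icc a b := Icc_subset_Icc_left hsab.1.le
  have hTc : IsCompact T := by
    have : IsClosed T := by
      have := (hf.mono hsub).preimage_isClosed_of_isClosed isClosed_Icc (isClosed_Iic (a := c))
      exact this
    exact isCompact_Icc.of_isClosed_subset this fun x hx => hx.1
  obtain ⟨x, hxT, hmax⟩ := hTc.exists_isGreatest ⟨s, ⟨le_rfl, hsab.2⟩, hc.1.le⟩
  have hxb : x < b := by
    refine hxT.1.2.lt_of_ne ?_
    rintro rfl
    exact (hxT.2.trans_lt hc.2).false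
  have hfx : f x = c := by
    refine hxT.2.antisymm ?_
    have hcont : ContinuousWithinAt f (Icc x b) x :=
      (hf x (hsub hxT.1)).mono (Icc_subset_Icc_left (hsub hxT.1).1)
    have hcont' : Tendsto f (𝓝[>] x) (𝓝 (f x)) := by
      have := hcont.mono Ioc_subset_Icc_self
      rwa [ContinuousWithinAt, nhdsWithin_Ioc_eq_nhdsGT hxb] at this
    refine ge_of_tendsto hcont' ?_
    filter_upwards [Ioc_mem_nhdsGT hxb] with y hy
    by_contra! hlt
    exact (hmax ⟨⟨hxT.1.1.trans hy.1.le, hy.2⟩, hlt.le⟩).not_gt hy.1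
  rcases hd x (hsub hxT.1) with h | h
  · exact hcS (hfx ▸ h)
  · obtain ⟨y, hy, hyb⟩ := ((hdec x h.1 h.2).and (Ioc_mem_nhdsGT hxb)).exists
    exact (hmax ⟨⟨hxT.1.1.trans hyb.1.le, hyb.2⟩, (hy.trans_eq hfx).le⟩).not_gt hyb.1

/-- The angle between two sides, whose (generalized) lengths have squares `A` and `B`, and whose
(generalized) inner product is `p`. -/
noncomputable def cosAngle (p A B : ℝ) : ℝ :=
  Real.arccos (p / (√A * √B))

theorem cosAngle_mem {p A B : ℝ} (hA : 0 < A) (hB : 0 < B) (h : A * B - p ^ 2 ≤ 0) :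
    cosAngle p A B ∈ ({0, Real.pi} : Set ℝ) := by
  have hs : 0 < √A * √B := by positivity
  have hsq : (√A * √B) ^ 2 ≤ p ^ 2 := by
    rw [mul_pow, Real.sq_sqrt hA.le, Real.sq_sqrt hB.le]; linarith
  rcases le_abs.1 ((le_abs_self _).trans (sq_le_sq.1 hsq)) with h | h
  · left
    exact Real.arccos_of_one_le ((one_le_div hs).2 h)
  · right
    refine Real.arccos_of_le_neg_one ?_
    rw [div_le_iff₀ hs]; linarith

theorem hasDerivAt_cosAngle {p A B : ℝ → ℝ} {p' A' B' t : ℝ} (hp : HasDerivAt p p' t)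
    (hA : HasDerivAt A A' t) (hB : HasDerivAt B B' t) (hA0 : 0 < A t) (hB0 : 0 < B t)
    (h : 0 < A t * B t - p t ^ 2) :
    HasDerivAt (fun s => cosAngle (p s) (A s) (B s))
      (-(p' - p t * (A' / (2 * A t) + B' / (2 * B t))) / √(A t * B t - p t ^ 2)) t := by
  have hsA : 0 < √(A t) := Real.sqrt_pos.2 hA0
  have hsB : 0 < √(B t) := Real.sqrt_pos.2 hB0
  have hqA : √(A t) ^ 2 = A t := Real.sq_sqrt hA0.le
  have hqB : √(B t) ^ 2 = B t := Real.sq_sqrt hB0.le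
  have hlt : (p t / (√(A t) * √(B t))) ^ 2 < 1 := by
    rw [div_pow, mul_pow, hqA, hqB, div_lt_one (by positivity)]
    linarith
  have habs := (sq_lt_one_iff_abs_lt_one _).1 hlt
  rw [abs_lt] at habs
  have hq := hp.div ((hA.sqrt hA0.ne').mul (hB.sqrt hB0.ne')) (mul_pos hsA hsB).ne'
  have := (Real.hasDerivAt_arccos habs.1.ne' habs.2.ne).comp t hq
  refine this.congr_deriv ?_
  have hroot : √(1 - (p t / (√(A t) * √(B t))) ^ 2) =
      √(A t * B t - p t ^ 2) / (√(A t) * √(B t)) := by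
    rw [← Real.sqrt_mul hA0.le, div_pow, Real.sq_sqrt (by positivity), ← Real.sqrt_div h.le]
    congr 1
    field_simp
  have hD : 0 < √(A t * B t - p t ^ 2) := Real.sqrt_pos.2 h
  simp only [Pi.mul_apply]
  rw [hroot]
  set sA := √(A t)
  set sB := √(B t)
  set D := √(A t * B t - p t ^ 2)
  rw [← hqA, ← hqB]
  field_simp

theorem continuousOn_cosAngle {p A B : ℝ → ℝ} {s : Set ℝ} (hp : ContinuousOn p s)
    (hA : ContinuousOn A s) (hB : ContinuousOn B s) (hA0 : ∀ t ∈ s, 0 < A t)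
    (hB0 : ∀ t ∈ s, 0 < B t) :
    ContinuousOn (fun t => cosAngle (p t) (A t) (B t)) s := by
  unfold cosAngle
  refine Real.continuous_arccos.comp_continuousOn (hp.div (hA.sqrt.mul hB.sqrt) fun t ht => ?_)
  have := Real.sqrt_pos.2 (hA0 t ht)
  have := Real.sqrt_pos.2 (hB0 t ht)
  positivity

/-- Along a path of generalized triangles the pairing of the angles with a fixed vector decreases,
provided its derivative is negative whenever the triangle is nondegenerate. -/
theorem angle_pairing_lt {p₁ p₂ p₃ A₁ A₂ A₃ p₁' p₂' p₃' A₁' A₂' A₃' : ℝ → ℝ} {v₁ v₂ v₃ : ℝ}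
    (hp₁ : ∀ t ∈ Icc (0 : ℝ) 1, HasDerivAt p₁ (p₁' t) t)
    (hp₂ : ∀ t ∈ Icc (0 : ℝ) 1, HasDerivAt p₂ (p₂' t) t)
    (hp₃ : ∀ t ∈ Icc (0 : ℝ) 1, HasDerivAt p₃ (p₃' t) t)
    (hA₁ : ∀ t ∈ Icc (0 : ℝ) 1, HasDerivAt A₁ (A₁' t) t)
    (hA₂ : ∀ t ∈ Icc (0 : ℝ) 1, HasDerivAt A₂ (A₂' t) t)
    (hA₃ : ∀ t ∈ Icc (0 : ℝ) 1, HasDerivAt A₃ (A₃' t) t)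
    (hA₁0 : ∀ t ∈ Icc (0 : ℝ) 1, 0 < A₁ t) (hA₂0 : ∀ t ∈ Icc (0 : ℝ) 1, 0 < A₂ t)
    (hA₃0 : ∀ t ∈ Icc (0 : ℝ) 1, 0 < A₃ t)
    (h₁₂ : ∀ t ∈ Icc (0 : ℝ) 1, A₃ t * A₁ t - p₂ t ^ 2 = A₂ t * A₃ t - p₁ t ^ 2)
    (h₁₃ : ∀ t ∈ Icc (0 : ℝ) 1, A₁ t * A₂ t - p₃ t ^ 2 = A₂ t * A₃ t - p₁ t ^ 2)
    (h0 : 0 < A₂ 0 * A₃ 0 - p₁ 0 ^ 2)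
    (hpos : ∀ t ∈ Icc (0 : ℝ) 1, 0 < A₂ t * A₃ t - p₁ t ^ 2 →
      0 < v₁ * (p₁' t - p₁ t * (A₂' t / (2 * A₂ t) + A₃' t / (2 * A₃ t)))
        + v₂ * (p₂' t - p₂ t * (A₃' t / (2 * A₃ t) + A₁' t / (2 * A₁ t)))
        + v₃ * (p₃' t - p₃ t * (A₁' t / (2 * A₁ t) + A₂' t / (2 * A₂ t)))) :
    v₁ * cosAngle (p₁ 1) (A₂ 1) (A₃ 1) + v₂ * cosAngle (p₂ 1) (A₃ 1) (A₁ 1)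
        + v₃ * cosAngle (p₃ 1) (A₁ 1) (A₂ 1) <
      v₁ * cosAngle (p₁ 0) (A₂ 0) (A₃ 0) + v₂ * cosAngle (p₂ 0) (A₃ 0) (A₁ 0)
        + v₃ * cosAngle (p₃ 0) (A₁ 0) (A₂ 0) := by
  set f : ℝ → ℝ := fun t => v₁ * cosAngle (p₁ t) (A₂ t) (A₃ t)
    + v₂ * cosAngle (p₂ t) (A₃ t) (A₁ t) + v₃ * cosAngle (p₃ t) (A₁ t) (A₂ t) with hf
  set D : ℝ → ℝ := fun t => A₂ t * A₃ t - p₁ t ^ 2 with hD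
  set f' : ℝ → ℝ := fun t =>
    -(v₁ * (p₁' t - p₁ t * (A₂' t / (2 * A₂ t) + A₃' t / (2 * A₃ t)))
        + v₂ * (p₂' t - p₂ t * (A₃' t / (2 * A₃ t) + A₁' t / (2 * A₁ t)))
        + v₃ * (p₃' t - p₃ t * (A₁' t / (2 * A₁ t) + A₂' t / (2 * A₂ t)))) / √(D t) with hf'
  have hderiv : ∀ t ∈ Icc (0 : ℝ) 1, 0 < D t → HasDerivAt f (f' t) t ∧ f' t < 0 := by
    intro t ht hDt
    constructor
    · have d₁ := hasDerivAt_cosAngle (hp₁ t ht) (hA₂ t ht) (hA₃ t ht) (hA₂0 t ht) (hA₃0 t ht) hDt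
      have d₂ := hasDerivAt_cosAngle (hp₂ t ht) (hA₃ t ht) (hA₁ t ht) (hA₃0 t ht) (hA₁0 t ht)
        (by rw [h₁₂ t ht]; exact hDt)
      have d₃ := hasDerivAt_cosAngle (hp₃ t ht) (hA₁ t ht) (hA₂ t ht) (hA₁0 t ht) (hA₂0 t ht)
        (by rw [h₁₃ t ht]; exact hDt)
      rw [h₁₂ t ht] at d₂
      rw [h₁₃ t ht] at d₃
      refine (((d₁.const_mul v₁).add (d₂.const_mul v₂)).add (d₃.const_mul v₃)).congr_deriv ?_
      simp only [hf', hD]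
      ring
    · exact div_neg_of_neg_of_pos (neg_neg_of_pos (hpos t ht hDt)) (Real.sqrt_pos.2 hDt)
  -- When `D t ≤ 0` all three clamped angles lie in `P`, so the pairing lies in the finite set `S`
  -- below.
  set P : Set ℝ := {0, Real.pi}
  have hP : P.Finite := Set.toFinite _
  set S : Set ℝ := (fun q : ℝ × ℝ × ℝ => v₁ * q.1 + v₂ * q.2.1 + v₃ * q.2.2) '' (P ×ˢ P ×ˢ P)
  have hS : S.Finite := (hP.prod (hP.prod hP)).image _
  have hcp₁ : ContinuousOn p₁ (Icc 0 1) := fun t ht => (hp₁ t ht).continuousAt.continuousWithinAt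
  have hcp₂ : ContinuousOn p₂ (Icc 0 1) := fun t ht => (hp₂ t ht).continuousAt.continuousWithinAt
  have hcp₃ : ContinuousOn p₃ (Icc 0 1) := fun t ht => (hp₃ t ht).continuousAt.continuousWithinAt
  have hcA₁ : ContinuousOn A₁ (Icc 0 1) := fun t ht => (hA₁ t ht).continuousAt.continuousWithinAt
  have hcA₂ : ContinuousOn A₂ (Icc 0 1) := fun t ht => (hA₂ t ht).continuousAt.continuousWithinAt
  have hcA₃ : ContinuousOn A₃ (Icc 0 1) := fun t ht => (hA₃ t ht).continuousAt.continuousWithinAt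
  refine lt_of_deriv_neg_off_finite (f := f) (f' := f') hS zero_lt_one ?_ ?_
    (hderiv 0 (left_mem_Icc.2 zero_le_one) h0)
  · exact (((continuousOn_cosAngle hcp₁ hcA₂ hcA₃ hA₂0 hA₃0).const_mul v₁).add
      ((continuousOn_cosAngle hcp₂ hcA₃ hcA₁ hA₃0 hA₁0).const_mul v₂)).add
      ((continuousOn_cosAngle hcp₃ hcA₁ hcA₂ hA₁0 hA₂0).const_mul v₃)
  · intro t ht
    rcases le_or_gt (D t) 0 with h | h
    · left
      exact ⟨(_, _, _), ⟨cosAngle_mem (hA₂0 t ht) (hA₃0 t ht) h,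
        cosAngle_mem (hA₃0 t ht) (hA₁0 t ht) ((h₁₂ t ht).trans_le h),
        cosAngle_mem (hA₁0 t ht) (hA₂0 t ht) ((h₁₃ t ht).trans_le h)⟩, rfl⟩
    · exact Or.inr (hderiv t ht h)

end InversiveDistance

namespace InversiveDistance
open Set

/-! ### Euclidean triangles -/

/-- The form is the weighted Laplacian of a triangle graph, and `w₁ w₂ + w₂ w₃ + w₃ w₁` is its
principal cofactor. The weight `w₃` may be negative. -/
theorem laplacian_pos {w₁ w₂ w₃ v₁ v₂ v₃ : ℝ} (h₁ : 0 ≤ w₁) (h₂ : 0 ≤ w₂)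
    (hσ : 0 < w₁ * w₂ + w₂ * w₃ + w₃ * w₁) (hv : ¬ (v₁ = v₂ ∧ v₂ = v₃)) :
    0 < w₁ * (v₂ - v₃) ^ 2 + w₂ * (v₃ - v₁) ^ 2 + w₃ * (v₁ - v₂) ^ 2 := by
  have hs : 0 < w₁ + w₂ := by
    rcases h₁.lt_or_eq with h | rfl
    · positivity
    rcases h₂.lt_or_eq with h | rfl
    · positivity
    simp at hσ
  refine pos_of_mul_pos_right (a := w₁ + w₂) ?_ hs.le
  have key : (w₁ + w₂) * (w₁ * (v₂ - v₃) ^ 2 + w₂ * (v₃ - v₁) ^ 2 + w₃ * (v₁ - v₂) ^ 2) =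
      (w₁ * (v₂ - v₃) - w₂ * (v₃ - v₁)) ^ 2
        + (w₁ * w₂ + w₂ * w₃ + w₃ * w₁) * (v₁ - v₂) ^ 2 := by ring
  rw [key]
  rcases eq_or_ne v₁ v₂ with rfl | h
  · have : v₁ - v₃ ≠ 0 := fun h => hv ⟨rfl, by linarith⟩
    have h4 : (w₁ * (v₁ - v₃) - w₂ * (v₃ - v₁)) = (w₁ + w₂) * (v₁ - v₃) := by ring
    rw [h4]
    positivity
  · have : v₁ - v₂ ≠ 0 := sub_ne_zero.2 h
    positivity

/-- The square of the length of an edge in Euclidean geometry. -/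
def sqLength (r₂ r₃ I₁ : ℝ) : ℝ := r₂ ^ 2 + r₃ ^ 2 + 2 * r₂ * r₃ * I₁

theorem sqLength_comm (r₂ r₃ I₁ : ℝ) : sqLength r₂ r₃ I₁ = sqLength r₃ r₂ I₁ := by
  unfold sqLength; ring

theorem sqLength_pos {r₂ r₃ I₁ : ℝ} (h₂ : 0 < r₂) (h₃ : 0 < r₃) (hI₁ : -1 < I₁) :
    0 < sqLength r₂ r₃ I₁ := by
  unfold sqLength
  have := mul_pos (mul_pos h₂ h₃) (by linarith : 0 < 1 + I₁)
  nlinarith [sq_nonneg (r₂ - r₃)]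

/-- The normalized derivative of an angle of a Euclidean triangle with respect to the
logarithmic radius at another vertex. -/
noncomputable def euclideanWeight (r₁ r₂ r₃ I₁ I₂ I₃ : ℝ) : ℝ :=
  r₂ * r₃ * height (r₂ * r₃) (r₃ * r₁) (r₁ * r₂) I₁ I₂ I₃ / sqLength r₂ r₃ I₁

theorem euclidean_area_eq (r₁ r₂ r₃ I₁ I₂ I₃ : ℝ) :
    sqLength r₃ r₁ I₂ * sqLength r₁ r₂ I₃
        - ((sqLength r₃ r₁ I₂ + sqLength r₁ r₂ I₃ - sqLength r₂ r₃ I₁) / 2) ^ 2 =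
      r₂ * r₃ * height (r₂ * r₃) (r₃ * r₁) (r₁ * r₂) I₁ I₂ I₃
        + r₃ * r₁ * height (r₃ * r₁) (r₁ * r₂) (r₂ * r₃) I₂ I₃ I₁
        + r₁ * r₂ * height (r₁ * r₂) (r₂ * r₃) (r₃ * r₁) I₃ I₁ I₂ := by
  unfold sqLength height; ring

/-- Euclidean counterpart of `height_gap_identity`. Divided by the three squared lengths, the left
side is the cofactor needed in `laplacian_pos`, and by `euclidean_area_eq` the first factor on the
right is four times the squared area. -/
theorem euclideanWeight_identity (r₁ r₂ r₃ I₁ I₂ I₃ : ℝ) :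
    (r₂ * r₃ * height (r₂ * r₃) (r₃ * r₁) (r₁ * r₂) I₁ I₂ I₃) *
        (r₃ * r₁ * height (r₃ * r₁) (r₁ * r₂) (r₂ * r₃) I₂ I₃ I₁) * sqLength r₁ r₂ I₃
      + (r₃ * r₁ * height (r₃ * r₁) (r₁ * r₂) (r₂ * r₃) I₂ I₃ I₁) *
        (r₁ * r₂ * height (r₁ * r₂) (r₂ * r₃) (r₃ * r₁) I₃ I₁ I₂) * sqLength r₂ r₃ I₁
      + (r₁ * r₂ * height (r₁ * r₂) (r₂ * r₃) (r₃ * r₁) I₃ I₁ I₂) *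
        (r₂ * r₃ * height (r₂ * r₃) (r₃ * r₁) (r₁ * r₂) I₁ I₂ I₃) * sqLength r₃ r₁ I₂ =
    (r₂ * r₃ * height (r₂ * r₃) (r₃ * r₁) (r₁ * r₂) I₁ I₂ I₃
        + r₃ * r₁ * height (r₃ * r₁) (r₁ * r₂) (r₂ * r₃) I₂ I₃ I₁
        + r₁ * r₂ * height (r₁ * r₂) (r₂ * r₃) (r₃ * r₁) I₃ I₁ I₂)
      * lengthJacobian (r₂ * r₃) (r₃ * r₁) (r₁ * r₂) I₁ I₂ I₃ := by
  unfold sqLength height lengthJacobian; ring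

theorem euclidean_form_pos {r₁ r₂ r₃ I₁ I₂ I₃ : ℝ} (hr₁ : 0 < r₁) (hr₂ : 0 < r₂) (hr₃ : 0 < r₃)
    (hI₁ : -1 < I₁) (hI₂ : -1 < I₂) (hI₃ : -1 < I₃) (h₁ : 0 ≤ I₁ + I₂ * I₃)
    (h₂ : 0 ≤ I₂ + I₁ * I₃) (h₃ : 0 ≤ I₃ + I₁ * I₂)
    (hA : 0 < sqLength r₃ r₁ I₂ * sqLength r₁ r₂ I₃
        - ((sqLength r₃ r₁ I₂ + sqLength r₁ r₂ I₃ - sqLength r₂ r₃ I₁) / 2) ^ 2)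
    {v₁ v₂ v₃ : ℝ} (hv : ¬ (v₁ = v₂ ∧ v₂ = v₃)) :
    0 < euclideanWeight r₁ r₂ r₃ I₁ I₂ I₃ * (v₂ - v₃) ^ 2
      + euclideanWeight r₂ r₃ r₁ I₂ I₃ I₁ * (v₃ - v₁) ^ 2
      + euclideanWeight r₃ r₁ r₂ I₃ I₁ I₂ * (v₁ - v₂) ^ 2 := by
  rw [euclidean_area_eq] at hA
  have hx := sqLength_pos hr₂ hr₃ hI₁
  have hy := sqLength_pos hr₃ hr₁ hI₂
  have hz := sqLength_pos hr₁ hr₂ hI₃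
  have k₁ := mul_pos hr₂ hr₃
  have k₂ := mul_pos hr₃ hr₁
  have k₃ := mul_pos hr₁ hr₂
  have hJ := mul_pos hA (lengthJacobian_pos k₁ k₂ k₃ hI₁ hI₂ hI₃ h₁ h₂ h₃)
  rw [← euclideanWeight_identity] at hJ
  have hσ : 0 < euclideanWeight r₁ r₂ r₃ I₁ I₂ I₃ * euclideanWeight r₂ r₃ r₁ I₂ I₃ I₁
      + euclideanWeight r₂ r₃ r₁ I₂ I₃ I₁ * euclideanWeight r₃ r₁ r₂ I₃ I₁ I₂
      + euclideanWeight r₃ r₁ r₂ I₃ I₁ I₂ * euclideanWeight r₁ r₂ r₃ I₁ I₂ I₃ := by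
    refine pos_of_mul_pos_right
      (a := sqLength r₂ r₃ I₁ * sqLength r₃ r₁ I₂ * sqLength r₁ r₂ I₃) ?_ (by positivity)
    refine hJ.trans_eq ?_
    unfold euclideanWeight
    field_simp
  have hw₁ : 0 ≤ height (r₂ * r₃) (r₃ * r₁) (r₁ * r₂) I₁ I₂ I₃ →
      0 ≤ euclideanWeight r₁ r₂ r₃ I₁ I₂ I₃ := fun h => div_nonneg (mul_nonneg k₁.le h) hx.le
  have hw₂ : 0 ≤ height (r₃ * r₁) (r₁ * r₂) (r₂ * r₃) I₂ I₃ I₁ →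
      0 ≤ euclideanWeight r₂ r₃ r₁ I₂ I₃ I₁ := fun h => div_nonneg (mul_nonneg k₂.le h) hy.le
  have hw₃ : 0 ≤ height (r₁ * r₂) (r₂ * r₃) (r₃ * r₁) I₃ I₁ I₂ →
      0 ≤ euclideanWeight r₃ r₁ r₂ I₃ I₁ I₂ := fun h => div_nonneg (mul_nonneg k₃.le h) hz.le
  rcases lt_or_ge (height (r₂ * r₃) (r₃ * r₁) (r₁ * r₂) I₁ I₂ I₃) 0 with n₁ | n₁
  · have := laplacian_pos (w₃ := euclideanWeight r₁ r₂ r₃ I₁ I₂ I₃)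
      (v₁ := v₂) (v₂ := v₃) (v₃ := v₁)
      (hw₂ (height_pos_of_neg k₁ k₂ k₃.le hI₁ hI₂ hI₃ h₁ h₂ h₃ n₁).le)
      (hw₃ (height_pos_of_neg' k₁ k₂.le k₃ hI₁ hI₂ hI₃ h₁ h₂ h₃ n₁).le)
      (by linarith) (fun h => hv ⟨(h.1.trans h.2).symm, h.1⟩)
    linarith
  rcases lt_or_ge (height (r₃ * r₁) (r₁ * r₂) (r₂ * r₃) I₂ I₃ I₁) 0 with n₂ | n₂
  · have := laplacian_pos (w₃ := euclideanWeight r₂ r₃ r₁ I₂ I₃ I₁)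
      (v₁ := v₃) (v₂ := v₁) (v₃ := v₂)
      (hw₃ (height_pos_of_neg k₂ k₃ k₁.le hI₂ hI₃ hI₁ (by linarith) (by linarith)
        (by linarith) n₂).le)
      (hw₁ n₁) (by linarith) (fun h => hv ⟨h.2, (h.1.trans h.2).symm⟩)
    linarith
  exact laplacian_pos (hw₁ n₁) (hw₂ n₂) hσ hv

/-- The left side is the bracket from `hasDerivAt_cosAngle`. Pairing the three brackets with `v`
gives `∑ wᵢ (vⱼ - vₖ)²`. -/
theorem euclidean_angle_deriv {r₁ r₂ r₃ I₁ I₂ I₃ : ℝ} (v₁ v₂ v₃ : ℝ)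
    (hy : 0 < sqLength r₃ r₁ I₂) (hz : 0 < sqLength r₁ r₂ I₃) :
    ((2 * v₃ * (r₃ ^ 2 + r₃ * r₁ * I₂) + 2 * v₁ * (r₁ ^ 2 + r₃ * r₁ * I₂))
        + (2 * v₁ * (r₁ ^ 2 + r₁ * r₂ * I₃) + 2 * v₂ * (r₂ ^ 2 + r₁ * r₂ * I₃))
        - (2 * v₂ * (r₂ ^ 2 + r₂ * r₃ * I₁) + 2 * v₃ * (r₃ ^ 2 + r₂ * r₃ * I₁))) / 2
      - (sqLength r₃ r₁ I₂ + sqLength r₁ r₂ I₃ - sqLength r₂ r₃ I₁) / 2 *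
        ((2 * v₃ * (r₃ ^ 2 + r₃ * r₁ * I₂) + 2 * v₁ * (r₁ ^ 2 + r₃ * r₁ * I₂))
            / (2 * sqLength r₃ r₁ I₂)
          + (2 * v₁ * (r₁ ^ 2 + r₁ * r₂ * I₃) + 2 * v₂ * (r₂ ^ 2 + r₁ * r₂ * I₃))
            / (2 * sqLength r₁ r₂ I₃)) =
    euclideanWeight r₃ r₁ r₂ I₃ I₁ I₂ * (v₁ - v₂)
      + euclideanWeight r₂ r₃ r₁ I₂ I₃ I₁ * (v₁ - v₃) := by
  unfold euclideanWeight
  field_simp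
  unfold sqLength height
  ring

/-- The inner angle at the first vertex of a (possibly degenerate) Euclidean triangle. -/
noncomputable def euclideanAngle (r₁ r₂ r₃ I₁ I₂ I₃ : ℝ) : ℝ :=
  cosAngle ((sqLength r₃ r₁ I₂ + sqLength r₁ r₂ I₃ - sqLength r₂ r₃ I₁) / 2)
    (sqLength r₃ r₁ I₂) (sqLength r₁ r₂ I₃)

theorem exists_euclidean_path {a b : ℝ} (ha : 0 < a) (hb : 0 < b) :
    ∃ r : ℝ → ℝ, r 0 = a ∧ r 1 = b ∧ ∀ t ∈ Icc (0 : ℝ) 1, 0 < r t ∧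
      HasDerivAt r ((Real.log b - Real.log a) * r t) t := by
  refine ⟨fun t => Real.exp (Real.log a + t * (Real.log b - Real.log a)), ?_, ?_, ?_⟩
  · simp [Real.exp_log ha]
  · simp [Real.exp_log hb]
  · intro t _
    refine ⟨Real.exp_pos _, ?_⟩
    have := (((hasDerivAt_id t).mul_const (Real.log b - Real.log a)).const_add (Real.log a)).exp
    refine this.congr_deriv ?_
    simp only [id, one_mul]
    ring

theorem hasDerivAt_sqLength {r₂ r₃ : ℝ → ℝ} {v₂ v₃ t : ℝ} (I₁ : ℝ)
    (h₂ : HasDerivAt r₂ (v₂ * r₂ t) t) (h₃ : HasDerivAt r₃ (v₃ * r₃ t) t) :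
    HasDerivAt (fun s => sqLength (r₂ s) (r₃ s) I₁)
      (2 * v₂ * (r₂ t ^ 2 + r₂ t * r₃ t * I₁) + 2 * v₃ * (r₃ t ^ 2 + r₂ t * r₃ t * I₁)) t := by
  unfold sqLength
  refine (((h₂.pow 2).add (h₃.pow 2)).add (((h₂.const_mul 2).mul h₃).mul_const I₁)).congr_deriv ?_
  simp only [Nat.cast_ofNat]
  ring

/-- The path is linear in the logarithmic radii, so `v` is its constant velocity. Only the initial
triangle has to be nondegenerate. -/
theorem euclidean_pairing_lt {r₁ r₂ r₃ s₁ s₂ s₃ I₁ I₂ I₃ : ℝ} (hr₁ : 0 < r₁) (hr₂ : 0 < r₂)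
    (hr₃ : 0 < r₃) (hs₁ : 0 < s₁) (hs₂ : 0 < s₂) (hs₃ : 0 < s₃)
    (hI₁ : -1 < I₁) (hI₂ : -1 < I₂) (hI₃ : -1 < I₃) (h₁ : 0 ≤ I₁ + I₂ * I₃)
    (h₂ : 0 ≤ I₂ + I₁ * I₃) (h₃ : 0 ≤ I₃ + I₁ * I₂)
    (hA : 0 < sqLength r₃ r₁ I₂ * sqLength r₁ r₂ I₃
        - ((sqLength r₃ r₁ I₂ + sqLength r₁ r₂ I₃ - sqLength r₂ r₃ I₁) / 2) ^ 2)
    {v₁ v₂ v₃ : ℝ} (hv₁ : v₁ = Real.log s₁ - Real.log r₁) (hv₂ : v₂ = Real.log s₂ - Real.log r₂)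
    (hv₃ : v₃ = Real.log s₃ - Real.log r₃) (hv : ¬ (v₁ = v₂ ∧ v₂ = v₃)) :
    v₁ * euclideanAngle s₁ s₂ s₃ I₁ I₂ I₃ + v₂ * euclideanAngle s₂ s₃ s₁ I₂ I₃ I₁
        + v₃ * euclideanAngle s₃ s₁ s₂ I₃ I₁ I₂ <
      v₁ * euclideanAngle r₁ r₂ r₃ I₁ I₂ I₃ + v₂ * euclideanAngle r₂ r₃ r₁ I₂ I₃ I₁
        + v₃ * euclideanAngle r₃ r₁ r₂ I₃ I₁ I₂ := by
  obtain ⟨ρ₁, rfl, rfl, hρ₁⟩ := exists_euclidean_path hr₁ hs₁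
  obtain ⟨ρ₂, rfl, rfl, hρ₂⟩ := exists_euclidean_path hr₂ hs₂
  obtain ⟨ρ₃, rfl, rfl, hρ₃⟩ := exists_euclidean_path hr₃ hs₃
  rw [← hv₁] at hρ₁
  rw [← hv₂] at hρ₂
  rw [← hv₃] at hρ₃
  have dx := fun t ht => hasDerivAt_sqLength I₁ (hρ₂ t ht).2 (hρ₃ t ht).2
  have dy := fun t ht => hasDerivAt_sqLength I₂ (hρ₃ t ht).2 (hρ₁ t ht).2
  have dz := fun t ht => hasDerivAt_sqLength I₃ (hρ₁ t ht).2 (hρ₂ t ht).2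
  have px := fun t ht => sqLength_pos (hρ₂ t ht).1 (hρ₃ t ht).1 hI₁
  have py := fun t ht => sqLength_pos (hρ₃ t ht).1 (hρ₁ t ht).1 hI₂
  have pz := fun t ht => sqLength_pos (hρ₁ t ht).1 (hρ₂ t ht).1 hI₃
  have := angle_pairing_lt (v₁ := v₁) (v₂ := v₂) (v₃ := v₃)
    (fun t ht => (((dy t ht).add (dz t ht)).sub (dx t ht)).div_const 2)
    (fun t ht => (((dz t ht).add (dx t ht)).sub (dy t ht)).div_const 2)
    (fun t ht => (((dx t ht).add (dy t ht)).sub (dz t ht)).div_const 2)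
    dx dy dz px py pz ?_ ?_ hA ?_
  · exact this
  · intro t _
    simp only [Pi.add_apply, Pi.sub_apply]
    ring
  · intro t _
    simp only [Pi.add_apply, Pi.sub_apply]
    ring
  · intro t ht hpos
    have hform := euclidean_form_pos (hρ₁ t ht).1 (hρ₂ t ht).1 (hρ₃ t ht).1 hI₁ hI₂ hI₃ h₁ h₂ h₃
      hpos hv
    simp only [Pi.add_apply, Pi.sub_apply]
    rw [euclidean_angle_deriv v₁ v₂ v₃ (py t ht) (pz t ht),
      euclidean_angle_deriv v₂ v₃ v₁ (pz t ht) (px t ht),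
      euclidean_angle_deriv v₃ v₁ v₂ (px t ht) (py t ht)]
    linarith

end InversiveDistance

namespace InversiveDistance
open Set

/-! ### Hyperbolic triangles -/

/-- The hyperbolic cosine of the length of an edge in hyperbolic geometry. -/
noncomputable def coshLength (r₂ r₃ I₁ : ℝ) : ℝ :=
  Real.cosh r₂ * Real.cosh r₃ + I₁ * (Real.sinh r₂ * Real.sinh r₃)

theorem coshLength_comm (r₂ r₃ I₁ : ℝ) : coshLength r₂ r₃ I₁ = coshLength r₃ r₂ I₁ := by
  unfold coshLength; ring

theorem one_lt_coshLength {r₂ r₃ I₁ : ℝ} (h₂ : 0 < r₂) (h₃ : 0 < r₃) (hI₁ : -1 < I₁) :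
    1 < coshLength r₂ r₃ I₁ := by
  have h := mul_pos (mul_pos (Real.sinh_pos_iff.2 h₂) (Real.sinh_pos_iff.2 h₃))
    (by linarith : 0 < 1 + I₁)
  have h' := Real.one_le_cosh (r₂ - r₃)
  rw [Real.cosh_sub] at h'
  unfold coshLength
  linarith

/-- The derivative of an angle of a hyperbolic triangle with respect to the logarithmic radius at
another vertex, in terms of the hyperbolic cosines of the edge lengths and of the radii. -/
noncomputable def hyperbolicWeight (X Y Z C₁ C₂ C₃ : ℝ) : ℝ :=
  (C₁ * (1 - X ^ 2) + C₂ * (X * Y - Z) + C₃ * (X * Z - Y)) / (X ^ 2 - 1)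

theorem hyperbolic_angle_deriv {X Y Z : ℝ} (C₁ C₂ C₃ v₁ v₂ v₃ : ℝ) (hY : 0 < Y ^ 2 - 1)
    (hZ : 0 < Z ^ 2 - 1) :
    ((v₃ * (C₃ * Y - C₁) + v₁ * (C₁ * Y - C₃)) * Z + Y * (v₁ * (C₁ * Z - C₂) + v₂ * (C₂ * Z - C₁))
        - (v₂ * (C₂ * X - C₃) + v₃ * (C₃ * X - C₂)))
      - (Y * Z - X) * (2 * Y * (v₃ * (C₃ * Y - C₁) + v₁ * (C₁ * Y - C₃)) / (2 * (Y ^ 2 - 1))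
        + 2 * Z * (v₁ * (C₁ * Z - C₂) + v₂ * (C₂ * Z - C₁)) / (2 * (Z ^ 2 - 1))) =
    hyperbolicWeight Z X Y C₃ C₁ C₂ * (Z * v₁ - v₂)
      + hyperbolicWeight Y Z X C₂ C₃ C₁ * (Y * v₁ - v₃) := by
  unfold hyperbolicWeight
  field_simp
  ring

theorem sq_coshLength_sub_one {k₂ k₃ S₂ S₃ : ℝ} (I₁ : ℝ)
    (h₂ : (S₂ * k₂) ^ 2 - S₂ ^ 2 = 1) (h₃ : (S₃ * k₃) ^ 2 - S₃ ^ 2 = 1) :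
    ((S₂ * k₂) * (S₃ * k₃) + I₁ * (S₂ * S₃)) ^ 2 - 1 = S₂ ^ 2 * S₃ ^ 2 * gap k₂ k₃ I₁ := by
  unfold gap
  linear_combination ((S₂ * k₂) ^ 2 - S₂ ^ 2) * h₃ + h₂

theorem hyperbolic_area_eq {k₁ k₂ k₃ S₁ S₂ S₃ : ℝ} (I₁ I₂ I₃ : ℝ)
    (h₁ : (S₁ * k₁) ^ 2 - S₁ ^ 2 = 1)
    (h₂ : (S₂ * k₂) ^ 2 - S₂ ^ 2 = 1) (h₃ : (S₃ * k₃) ^ 2 - S₃ ^ 2 = 1) {X Y Z : ℝ}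
    (hX : X = (S₂ * k₂) * (S₃ * k₃) + I₁ * (S₂ * S₃))
    (hY : Y = (S₃ * k₃) * (S₁ * k₁) + I₂ * (S₃ * S₁))
    (hZ : Z = (S₁ * k₁) * (S₂ * k₂) + I₃ * (S₁ * S₂)) :
    (Y ^ 2 - 1) * (Z ^ 2 - 1) - (Y * Z - X) ^ 2 =
      S₁ ^ 2 * S₂ ^ 2 * S₃ ^ 2 * discr k₁ k₂ k₃ I₁ I₂ I₃ := by
  -- Homogenizing `1 + 2XYZ - X² - Y² - Z²` by writing `1 = (Sᵢ kᵢ)² - Sᵢ²` makes it a polynomial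
  -- identity.
  have key : ((S₁ * k₁) ^ 2 - S₁ ^ 2) * ((S₂ * k₂) ^ 2 - S₂ ^ 2) * ((S₃ * k₃) ^ 2 - S₃ ^ 2)
      + 2 * X * Y * Z - ((S₁ * k₁) ^ 2 - S₁ ^ 2) * X ^ 2 - ((S₂ * k₂) ^ 2 - S₂ ^ 2) * Y ^ 2
      - ((S₃ * k₃) ^ 2 - S₃ ^ 2) * Z ^ 2 =
      S₁ ^ 2 * S₂ ^ 2 * S₃ ^ 2 * discr k₁ k₂ k₃ I₁ I₂ I₃ := by
    rw [hX, hY, hZ]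
    unfold discr height
    ring
  rw [← key, h₁, h₂, h₃]
  ring

theorem hyperbolicWeight_eq {k₁ k₂ k₃ S₁ S₂ S₃ : ℝ} (I₁ I₂ I₃ : ℝ) (hS₂ : 0 < S₂) (hS₃ : 0 < S₃)
    (h₂ : (S₂ * k₂) ^ 2 - S₂ ^ 2 = 1) (h₃ : (S₃ * k₃) ^ 2 - S₃ ^ 2 = 1) {X Y Z : ℝ}
    (hX : X = (S₂ * k₂) * (S₃ * k₃) + I₁ * (S₂ * S₃))
    (hY : Y = (S₃ * k₃) * (S₁ * k₁) + I₂ * (S₃ * S₁))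
    (hZ : Z = (S₁ * k₁) * (S₂ * k₂) + I₃ * (S₁ * S₂)) :
    hyperbolicWeight X Y Z (S₁ * k₁) (S₂ * k₂) (S₃ * k₃) = S₁ * weight k₁ k₂ k₃ I₁ I₂ I₃ := by
  have hnum : (S₁ * k₁) * (1 - X ^ 2) + (S₂ * k₂) * (X * Y - Z) + (S₃ * k₃) * (X * Z - Y) =
      (S₂ ^ 2 * S₃ ^ 2) * (S₁ * height k₁ k₂ k₃ I₁ I₂ I₃) := by
    rw [hX, hY, hZ]
    unfold height
    linear_combination (I₂ * S₃ * S₁ * (S₃ * k₃) + (S₁ * k₁) * S₃ ^ 2) * h₂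
      + (I₃ * S₁ * S₂ * (S₂ * k₂) + (S₁ * k₁) * ((S₂ * k₂) ^ 2 - 1)) * h₃
  unfold hyperbolicWeight weight
  rw [hnum, hX, sq_coshLength_sub_one I₁ h₂ h₃, mul_div_mul_left _ _ (by positivity),
    mul_div_assoc]

/-- Here `Sᵢ = sinh rᵢ` and `kᵢ = coth rᵢ`, so `kᵢ² - 1 = 1 / Sᵢ²`. The substitution `zᵢ = Sᵢ vᵢ`
therefore absorbs the factors `eᵢ` of `triangleForm`. -/
theorem hyperbolic_form_eq {k₁ k₂ k₃ S₁ S₂ S₃ : ℝ} (I₁ I₂ I₃ : ℝ)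
    (hS₁ : 0 < S₁) (hS₂ : 0 < S₂) (hS₃ : 0 < S₃) (h₁ : (S₁ * k₁) ^ 2 - S₁ ^ 2 = 1)
    (h₂ : (S₂ * k₂) ^ 2 - S₂ ^ 2 = 1) (h₃ : (S₃ * k₃) ^ 2 - S₃ ^ 2 = 1) {X Y Z : ℝ}
    (hX : X = (S₂ * k₂) * (S₃ * k₃) + I₁ * (S₂ * S₃))
    (hY : Y = (S₃ * k₃) * (S₁ * k₁) + I₂ * (S₃ * S₁))
    (hZ : Z = (S₁ * k₁) * (S₂ * k₂) + I₃ * (S₁ * S₂)) (v₁ v₂ v₃ : ℝ) :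
    hyperbolicWeight X Y Z (S₁ * k₁) (S₂ * k₂) (S₃ * k₃) *
        (X * (v₂ ^ 2 + v₃ ^ 2) - 2 * (v₂ * v₃))
      + hyperbolicWeight Y Z X (S₂ * k₂) (S₃ * k₃) (S₁ * k₁) *
        (Y * (v₃ ^ 2 + v₁ ^ 2) - 2 * (v₃ * v₁))
      + hyperbolicWeight Z X Y (S₃ * k₃) (S₁ * k₁) (S₂ * k₂) *
        (Z * (v₁ ^ 2 + v₂ ^ 2) - 2 * (v₁ * v₂)) =
    S₁ * S₂ * S₃ * triangleForm (weight k₁ k₂ k₃ I₁ I₂ I₃) (weight k₂ k₃ k₁ I₂ I₃ I₁)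
        (weight k₃ k₁ k₂ I₃ I₁ I₂) (k₂ * k₃ + I₁) (k₃ * k₁ + I₂) (k₁ * k₂ + I₃)
        (k₁ ^ 2 - 1) (k₂ ^ 2 - 1) (k₃ ^ 2 - 1) (S₁ * v₁) (S₂ * v₂) (S₃ * v₃) := by
  rw [hyperbolicWeight_eq I₁ I₂ I₃ hS₂ hS₃ h₂ h₃ hX hY hZ,
    hyperbolicWeight_eq I₂ I₃ I₁ hS₃ hS₁ h₃ h₁ hY hZ hX,
    hyperbolicWeight_eq I₃ I₁ I₂ hS₁ hS₂ h₁ h₂ hZ hX hY]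
  have e₁ : k₁ ^ 2 - 1 = 1 / S₁ ^ 2 := by field_simp; linarith
  have e₂ : k₂ ^ 2 - 1 = 1 / S₂ ^ 2 := by field_simp; linarith
  have e₃ : k₃ ^ 2 - 1 = 1 / S₃ ^ 2 := by field_simp; linarith
  rw [e₁, e₂, e₃, hX, hY, hZ]
  unfold triangleForm
  field_simp

/-- The inner angle at the first vertex of a (possibly degenerate) hyperbolic triangle. -/
noncomputable def hyperbolicAngle (r₁ r₂ r₃ I₁ I₂ I₃ : ℝ) : ℝ :=
  cosAngle (coshLength r₃ r₁ I₂ * coshLength r₁ r₂ I₃ - coshLength r₂ r₃ I₁)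
    (coshLength r₃ r₁ I₂ ^ 2 - 1) (coshLength r₁ r₂ I₃ ^ 2 - 1)

theorem hyperbolic_form_pos {r₁ r₂ r₃ I₁ I₂ I₃ : ℝ} (hr₁ : 0 < r₁) (hr₂ : 0 < r₂) (hr₃ : 0 < r₃)
    (hI₁ : -1 < I₁) (hI₂ : -1 < I₂) (hI₃ : -1 < I₃) (h₁ : 0 ≤ I₁ + I₂ * I₃)
    (h₂ : 0 ≤ I₂ + I₁ * I₃) (h₃ : 0 ≤ I₃ + I₁ * I₂) {X Y Z : ℝ} (hX : X = coshLength r₂ r₃ I₁)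
    (hY : Y = coshLength r₃ r₁ I₂) (hZ : Z = coshLength r₁ r₂ I₃)
    (hA : 0 < (Y ^ 2 - 1) * (Z ^ 2 - 1) - (Y * Z - X) ^ 2)
    {v₁ v₂ v₃ : ℝ} (hv : ¬ (v₁ = 0 ∧ v₂ = 0 ∧ v₃ = 0)) :
    0 < hyperbolicWeight X Y Z (Real.cosh r₁) (Real.cosh r₂) (Real.cosh r₃) *
        (X * (v₂ ^ 2 + v₃ ^ 2) - 2 * (v₂ * v₃))
      + hyperbolicWeight Y Z X (Real.cosh r₂) (Real.cosh r₃) (Real.cosh r₁) *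
        (Y * (v₃ ^ 2 + v₁ ^ 2) - 2 * (v₃ * v₁))
      + hyperbolicWeight Z X Y (Real.cosh r₃) (Real.cosh r₁) (Real.cosh r₂) *
        (Z * (v₁ ^ 2 + v₂ ^ 2) - 2 * (v₁ * v₂)) := by
  have aux : ∀ r : ℝ, 0 < r → ∃ k, 1 < k ∧ Real.cosh r = Real.sinh r * k ∧
      (Real.sinh r * k) ^ 2 - Real.sinh r ^ 2 = 1 := by
    intro r hr
    have hS := Real.sinh_pos_iff.2 hr
    have e : Real.cosh r = Real.sinh r * (Real.cosh r / Real.sinh r) := by field_simp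
    refine ⟨Real.cosh r / Real.sinh r, (one_lt_div hS).2 (Real.sinh_lt_cosh r), e, ?_⟩
    rw [← e, Real.cosh_sq]
    ring
  obtain ⟨k₁, hk₁, c₁, q₁⟩ := aux r₁ hr₁
  obtain ⟨k₂, hk₂, c₂, q₂⟩ := aux r₂ hr₂
  obtain ⟨k₃, hk₃, c₃, q₃⟩ := aux r₃ hr₃
  have S₁ := Real.sinh_pos_iff.2 hr₁
  have S₂ := Real.sinh_pos_iff.2 hr₂
  have S₃ := Real.sinh_pos_iff.2 hr₃
  rw [coshLength, c₂, c₃] at hX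
  rw [coshLength, c₃, c₁] at hY
  rw [coshLength, c₁, c₂] at hZ
  rw [hyperbolic_area_eq I₁ I₂ I₃ q₁ q₂ q₃ hX hY hZ] at hA
  rw [c₁, c₂, c₃, hyperbolic_form_eq I₁ I₂ I₃ S₁ S₂ S₃ q₁ q₂ q₃ hX hY hZ]
  refine mul_pos (by positivity) (triangleForm_weight_pos hk₁ hk₂ hk₃ hI₁ hI₂ hI₃ h₁ h₂ h₃
    (pos_of_mul_pos_right hA (by positivity)) ?_)
  simpa [S₁.ne', S₂.ne', S₃.ne'] using hv

theorem log_tanh_half_inj {a b : ℝ} (ha : 0 < a) (hb : 0 < b)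
    (h : Real.log (Real.tanh (a / 2)) = Real.log (Real.tanh (b / 2))) : a = b := by
  have hpos : ∀ x : ℝ, 0 < x → 0 < Real.tanh (x / 2) := fun x hx => by
    rw [Real.tanh_eq_sinh_div_cosh]
    exact div_pos (Real.sinh_pos_iff.2 (by linarith)) (Real.cosh_pos _)
  have := Real.log_injOn_pos (hpos a ha) (hpos b hb) h
  have := congrArg Real.artanh this
  rw [Real.artanh_tanh, Real.artanh_tanh] at this
  linarith

theorem exists_hyperbolic_path {a b : ℝ} (ha : 0 < a) (hb : 0 < b) :
    ∃ r : ℝ → ℝ, r 0 = a ∧ r 1 = b ∧ ∀ t ∈ Icc (0 : ℝ) 1, 0 < r t ∧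
      HasDerivAt r ((Real.log (Real.tanh (b / 2)) - Real.log (Real.tanh (a / 2)))
        * Real.sinh (r t)) t := by
  have hpos : ∀ x : ℝ, 0 < x → 0 < Real.tanh (x / 2) := fun x hx => by
    rw [Real.tanh_eq_sinh_div_cosh]
    exact div_pos (Real.sinh_pos_iff.2 (by linarith)) (Real.cosh_pos _)
  have hend : ∀ x : ℝ, 0 < x →
      Real.log ((1 + Real.tanh (x / 2)) / (1 - Real.tanh (x / 2))) = x := by
    intro x _
    have h := Real.artanh_eq_half_log (x := Real.tanh (x / 2))
      ⟨(Real.neg_one_lt_tanh _).le, (Real.tanh_lt_one _).le⟩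
    rw [Real.artanh_tanh] at h
    linarith
  set α := Real.log (Real.tanh (a / 2)) with hα
  set β := Real.log (Real.tanh (b / 2)) with hβ
  have hα0 : α < 0 := Real.log_neg (hpos a ha) (Real.tanh_lt_one _)
  have hβ0 : β < 0 := Real.log_neg (hpos b hb) (Real.tanh_lt_one _)
  -- This is `2 artanh τ` with `log τ` affine in `t`, so `log tanh (r / 2)` moves at constant speed.
  -- Its endpoint values are negative, which keeps `τ < 1`.
  refine ⟨fun t => Real.log ((1 + Real.exp (α + t * (β - α))) / (1 - Real.exp (α + t * (β - α)))),
    ?_, ?_, ?_⟩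
  · simp only [zero_mul, add_zero]
    rw [hα, Real.exp_log (hpos a ha), hend a ha]
  · simp only [one_mul, add_sub_cancel]
    rw [hβ, Real.exp_log (hpos b hb), hend b hb]
  · intro t ht
    have hneg : α + t * (β - α) < 0 := by
      have : α + t * (β - α) = (1 - t) * α + t * β := by ring
      rw [this]
      rcases ht.1.eq_or_lt with rfl | h
      · simpa using hα0
      · nlinarith [ht.2]
    have hτ := ((((hasDerivAt_id t).mul_const (β - α)).const_add α).exp)
    simp only [id, one_mul] at hτ
    set τ := Real.exp (α + t * (β - α)) with hτd
    have hτ0 : 0 < τ := Real.exp_pos _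
    have hτ1 : τ < 1 := Real.exp_lt_one_iff.2 hneg
    have h1 : 0 < 1 - τ := by linarith
    have hq : 1 < (1 + τ) / (1 - τ) := by rw [one_lt_div h1]; linarith
    refine ⟨Real.log_pos hq, ?_⟩
    have hd := ((hτ.const_add 1).div (hτ.const_sub 1) h1.ne').log (zero_lt_one.trans hq).ne'
    refine hd.congr_deriv ?_
    simp only [Pi.div_apply]
    rw [← hτd, Real.sinh_log (zero_lt_one.trans hq)]
    have : 0 < 1 + τ := by linarith
    field_simp
    ring

theorem hasDerivAt_coshLength {r₂ r₃ : ℝ → ℝ} {v₂ v₃ t : ℝ} (I₁ : ℝ)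
    (h₂ : HasDerivAt r₂ (v₂ * Real.sinh (r₂ t)) t) (h₃ : HasDerivAt r₃ (v₃ * Real.sinh (r₃ t)) t) :
    HasDerivAt (fun s => coshLength (r₂ s) (r₃ s) I₁)
      (v₂ * (Real.cosh (r₂ t) * coshLength (r₂ t) (r₃ t) I₁ - Real.cosh (r₃ t))
        + v₃ * (Real.cosh (r₃ t) * coshLength (r₂ t) (r₃ t) I₁ - Real.cosh (r₂ t))) t := by
  unfold coshLength
  refine ((h₂.cosh.mul h₃.cosh).add ((h₂.sinh.mul h₃.sinh).const_mul I₁)).congr_deriv ?_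
  linear_combination
    -(v₂ * Real.cosh (r₃ t)) * Real.cosh_sq (r₂ t) - (v₃ * Real.cosh (r₂ t)) * Real.cosh_sq (r₃ t)

theorem hyperbolic_pairing_lt {r₁ r₂ r₃ s₁ s₂ s₃ I₁ I₂ I₃ : ℝ} (hr₁ : 0 < r₁) (hr₂ : 0 < r₂)
    (hr₃ : 0 < r₃) (hs₁ : 0 < s₁) (hs₂ : 0 < s₂) (hs₃ : 0 < s₃)
    (hI₁ : -1 < I₁) (hI₂ : -1 < I₂) (hI₃ : -1 < I₃) (h₁ : 0 ≤ I₁ + I₂ * I₃)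
    (h₂ : 0 ≤ I₂ + I₁ * I₃) (h₃ : 0 ≤ I₃ + I₁ * I₂)
    (hA : 0 < (coshLength r₃ r₁ I₂ ^ 2 - 1) * (coshLength r₁ r₂ I₃ ^ 2 - 1)
        - (coshLength r₃ r₁ I₂ * coshLength r₁ r₂ I₃ - coshLength r₂ r₃ I₁) ^ 2)
    {v₁ v₂ v₃ : ℝ} (hv₁ : v₁ = Real.log (Real.tanh (s₁ / 2)) - Real.log (Real.tanh (r₁ / 2)))
    (hv₂ : v₂ = Real.log (Real.tanh (s₂ / 2)) - Real.log (Real.tanh (r₂ / 2)))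
    (hv₃ : v₃ = Real.log (Real.tanh (s₃ / 2)) - Real.log (Real.tanh (r₃ / 2)))
    (hv : ¬ (v₁ = 0 ∧ v₂ = 0 ∧ v₃ = 0)) :
    v₁ * hyperbolicAngle s₁ s₂ s₃ I₁ I₂ I₃ + v₂ * hyperbolicAngle s₂ s₃ s₁ I₂ I₃ I₁
        + v₃ * hyperbolicAngle s₃ s₁ s₂ I₃ I₁ I₂ <
      v₁ * hyperbolicAngle r₁ r₂ r₃ I₁ I₂ I₃ + v₂ * hyperbolicAngle r₂ r₃ r₁ I₂ I₃ I₁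
        + v₃ * hyperbolicAngle r₃ r₁ r₂ I₃ I₁ I₂ := by
  obtain ⟨ρ₁, rfl, rfl, hρ₁⟩ := exists_hyperbolic_path hr₁ hs₁
  obtain ⟨ρ₂, rfl, rfl, hρ₂⟩ := exists_hyperbolic_path hr₂ hs₂
  obtain ⟨ρ₃, rfl, rfl, hρ₃⟩ := exists_hyperbolic_path hr₃ hs₃
  rw [← hv₁] at hρ₁
  rw [← hv₂] at hρ₂
  rw [← hv₃] at hρ₃
  have dx := fun t ht => hasDerivAt_coshLength I₁ (hρ₂ t ht).2 (hρ₃ t ht).2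
  have dy := fun t ht => hasDerivAt_coshLength I₂ (hρ₃ t ht).2 (hρ₁ t ht).2
  have dz := fun t ht => hasDerivAt_coshLength I₃ (hρ₁ t ht).2 (hρ₂ t ht).2
  have aux : ∀ {x : ℝ}, 1 < x → 0 < x ^ 2 - 1 := fun h => by nlinarith
  have px := fun t ht => aux (one_lt_coshLength (hρ₂ t ht).1 (hρ₃ t ht).1 hI₁)
  have py := fun t ht => aux (one_lt_coshLength (hρ₃ t ht).1 (hρ₁ t ht).1 hI₂)
  have pz := fun t ht => aux (one_lt_coshLength (hρ₁ t ht).1 (hρ₂ t ht).1 hI₃)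
  have := angle_pairing_lt (v₁ := v₁) (v₂ := v₂) (v₃ := v₃)
    (fun t ht => ((dy t ht).mul (dz t ht)).sub (dx t ht))
    (fun t ht => ((dz t ht).mul (dx t ht)).sub (dy t ht))
    (fun t ht => ((dx t ht).mul (dy t ht)).sub (dz t ht))
    (fun t ht => ((dx t ht).pow 2).sub_const 1)
    (fun t ht => ((dy t ht).pow 2).sub_const 1)
    (fun t ht => ((dz t ht).pow 2).sub_const 1) px py pz ?_ ?_ hA ?_
  · exact this
  · intro t _
    simp only [Pi.mul_apply, Pi.sub_apply, Pi.pow_apply]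
    ring
  · intro t _
    simp only [Pi.mul_apply, Pi.sub_apply, Pi.pow_apply]
    ring
  · intro t ht hpos
    have hform := hyperbolic_form_pos (hρ₁ t ht).1 (hρ₂ t ht).1 (hρ₃ t ht).1 hI₁ hI₂ hI₃ h₁ h₂ h₃
      rfl rfl rfl hpos hv
    simp only [Pi.mul_apply, Pi.sub_apply, Pi.pow_apply, Nat.cast_ofNat, Nat.add_one_sub_one,
      pow_one]
    rw [hyperbolic_angle_deriv _ _ _ v₁ v₂ v₃ (py t ht) (pz t ht),
      hyperbolic_angle_deriv _ _ _ v₂ v₃ v₁ (pz t ht) (px t ht),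
      hyperbolic_angle_deriv _ _ _ v₃ v₁ v₂ (px t ht) (py t ht)]
    linarith

end InversiveDistance

namespace InversiveDistance

/-! ### The angles of a triangle of the surface -/

theorem cosAngle_scale {c : ℝ} (hc : 0 < c) (p A B : ℝ) :
    cosAngle (c ^ 2 * p) (c ^ 2 * A) (c ^ 2 * B) = cosAngle p A B := by
  unfold cosAngle
  rw [Real.sqrt_mul (by positivity), Real.sqrt_mul (by positivity), Real.sqrt_sq hc.le]
  congr 1
  rw [show c * √A * (c * √B) = c ^ 2 * (√A * √B) by ring]
  exact mul_div_mul_left _ _ (by positivity)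

theorem euclideanAngle_scale {c : ℝ} (hc : 0 < c) (r₁ r₂ r₃ I₁ I₂ I₃ : ℝ) :
    euclideanAngle (c * r₁) (c * r₂) (c * r₃) I₁ I₂ I₃ = euclideanAngle r₁ r₂ r₃ I₁ I₂ I₃ := by
  have h : ∀ a b I : ℝ, sqLength (c * a) (c * b) I = c ^ 2 * sqLength a b I := by
    intro a b I; unfold sqLength; ring
  unfold euclideanAngle
  rw [h, h, h, ← cosAngle_scale hc (_ / 2) (sqLength r₃ r₁ I₂)]
  congr 1
  ring

variable {V : Type*}

theorem scaleFactor_pos (g : Background) {r : V → ℝ} (hr : ∀ i, 0 < r i) (i : V) :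
    0 < scaleFactor g r i := by
  cases g
  · exact hr i
  · change 0 < Real.tanh (r i / 2)
    rw [Real.tanh_eq_sinh_div_cosh]
    exact div_pos (Real.sinh_pos_iff.2 (by linarith [hr i])) (Real.cosh_pos _)

/-- The difference of the logarithmic radii of two circle packings. -/
noncomputable def logChange (g : Background) (r s : V → ℝ) (i : V) : ℝ :=
  Real.log (scaleFactor g s i) - Real.log (scaleFactor g r i)

theorem eq_exp_logChange_mul {r s : V → ℝ} (hr : ∀ i, 0 < r i) (hs : ∀ i, 0 < s i) (i : V) :
    s i = Real.exp (logChange .euclidean r s i) * r i := by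
  change s i = Real.exp (Real.log (s i) - Real.log (r i)) * r i
  rw [Real.exp_sub, Real.exp_log (hs i), Real.exp_log (hr i), div_mul_cancel₀ _ (hr i).ne']

theorem eq_of_logChange_eq_zero {r s : V → ℝ} (hr : ∀ i, 0 < r i) (hs : ∀ i, 0 < s i) {i : V}
    (h : logChange .hyperbolic r s i = 0) : r i = s i :=
  log_tanh_half_inj (hr i) (hs i) (sub_eq_zero.1 h).symm

variable [DecidableEq V]

theorem angle_euclidean_eq (I : Finset V → ℝ) {r : V → ℝ} (hr : ∀ i, 0 < r i) {i j k : V}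
    (hij : -1 < I {i, j}) (hik : -1 < I {i, k}) (hjk : -1 < I {j, k}) :
    angle .euclidean I r i j k =
      euclideanAngle (r i) (r j) (r k) (I {j, k}) (I {i, k}) (I {i, j}) := by
  have hx := sqLength_pos (hr j) (hr k) hjk
  have hy := sqLength_pos (hr i) (hr k) hik
  have hz := sqLength_pos (hr i) (hr j) hij
  unfold angle euclideanAngle cosAngle
  rw [sqLength_comm (r k) (r i)]
  change Real.arccos ((√(sqLength (r i) (r k) (I {i, k})) ^ 2
    + √(sqLength (r i) (r j) (I {i, j})) ^ 2
    - √(sqLength (r j) (r k) (I {j, k})) ^ 2) / (2 * √(sqLength (r i) (r k) (I {i, k}))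
      * √(sqLength (r i) (r j) (I {i, j})))) = _
  rw [Real.sq_sqrt hx.le, Real.sq_sqrt hy.le, Real.sq_sqrt hz.le]
  congr 1
  have := Real.sqrt_pos.2 hy
  have := Real.sqrt_pos.2 hz
  field_simp

theorem angle_hyperbolic_eq (I : Finset V → ℝ) {r : V → ℝ} (hr : ∀ i, 0 < r i) {i j k : V}
    (hij : -1 < I {i, j}) (hik : -1 < I {i, k}) (hjk : -1 < I {j, k}) :
    angle .hyperbolic I r i j k =
      hyperbolicAngle (r i) (r j) (r k) (I {j, k}) (I {i, k}) (I {i, j}) := by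
  have hx := one_lt_coshLength (hr j) (hr k) hjk
  have hy := one_lt_coshLength (hr i) (hr k) hik
  have hz := one_lt_coshLength (hr i) (hr j) hij
  unfold angle hyperbolicAngle cosAngle
  rw [coshLength_comm (r k) (r i)]
  change Real.arccos ((Real.cosh (Real.arcosh (coshLength (r i) (r k) (I {i, k})))
    * Real.cosh (Real.arcosh (coshLength (r i) (r j) (I {i, j})))
    - Real.cosh (Real.arcosh (coshLength (r j) (r k) (I {j, k})))) /
    (Real.sinh (Real.arcosh (coshLength (r i) (r k) (I {i, k})))
    * Real.sinh (Real.arcosh (coshLength (r i) (r j) (I {i, j}))))) = _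
  rw [Real.cosh_arcosh hx.le, Real.cosh_arcosh hy.le, Real.cosh_arcosh hz.le,
    Real.sinh_arcosh hy.le, Real.sinh_arcosh hz.le]

theorem euclidean_area_pos (I : Finset V → ℝ) {r : V → ℝ} (hr : ∀ i, 0 < r i) {i j k : V}
    (hij : -1 < I {i, j}) (hik : -1 < I {i, k}) (hjk : -1 < I {j, k})
    (hi : edgeLength .euclidean I r j k <
      edgeLength .euclidean I r i j + edgeLength .euclidean I r i k)
    (hj : edgeLength .euclidean I r i k <
      edgeLength .euclidean I r i j + edgeLength .euclidean I r j k)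
    (hk : edgeLength .euclidean I r i j <
      edgeLength .euclidean I r i k + edgeLength .euclidean I r j k) :
    0 < sqLength (r k) (r i) (I {i, k}) * sqLength (r i) (r j) (I {i, j})
        - ((sqLength (r k) (r i) (I {i, k}) + sqLength (r i) (r j) (I {i, j})
          - sqLength (r j) (r k) (I {j, k})) / 2) ^ 2 := by
  have hx := sqLength_pos (hr j) (hr k) hjk
  have hy := sqLength_pos (hr i) (hr k) hik
  have hz := sqLength_pos (hr i) (hr j) hij
  have ex : edgeLength .euclidean I r j k = √(sqLength (r j) (r k) (I {j, k})) := rfl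
  have ey : edgeLength .euclidean I r i k = √(sqLength (r i) (r k) (I {i, k})) := rfl
  have ez : edgeLength .euclidean I r i j = √(sqLength (r i) (r j) (I {i, j})) := rfl
  have pa : 0 < edgeLength .euclidean I r j k := ex ▸ Real.sqrt_pos.2 hx
  have pb : 0 < edgeLength .euclidean I r i k := ey ▸ Real.sqrt_pos.2 hy
  have pc : 0 < edgeLength .euclidean I r i j := ez ▸ Real.sqrt_pos.2 hz
  rw [sqLength_comm (r k) (r i), ← Real.sq_sqrt hx.le, ← Real.sq_sqrt hy.le, ← Real.sq_sqrt hz.le,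
    ← ex, ← ey, ← ez]
  set a := edgeLength .euclidean I r j k
  set b := edgeLength .euclidean I r i k
  set c := edgeLength .euclidean I r i j
  have key : b ^ 2 * c ^ 2 - ((b ^ 2 + c ^ 2 - a ^ 2) / 2) ^ 2 =
      (a + b + c) * (c + b - a) * (c + a - b) * (b + a - c) / 4 := by ring
  rw [key]
  have := sub_pos.2 hi
  have := sub_pos.2 hj
  have := sub_pos.2 hk
  positivity

theorem hyperbolic_area_pos (I : Finset V → ℝ) {r : V → ℝ} (hr : ∀ i, 0 < r i) {i j k : V}
    (hij : -1 < I {i, j}) (hik : -1 < I {i, k}) (hjk : -1 < I {j, k})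
    (hi : edgeLength .hyperbolic I r j k <
      edgeLength .hyperbolic I r i j + edgeLength .hyperbolic I r i k)
    (hj : edgeLength .hyperbolic I r i k <
      edgeLength .hyperbolic I r i j + edgeLength .hyperbolic I r j k)
    (hk : edgeLength .hyperbolic I r i j <
      edgeLength .hyperbolic I r i k + edgeLength .hyperbolic I r j k) :
    0 < (coshLength (r k) (r i) (I {i, k}) ^ 2 - 1) * (coshLength (r i) (r j) (I {i, j}) ^ 2 - 1)
        - (coshLength (r k) (r i) (I {i, k}) * coshLength (r i) (r j) (I {i, j})
          - coshLength (r j) (r k) (I {j, k})) ^ 2 := by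
  have hx := one_lt_coshLength (hr j) (hr k) hjk
  have hy := one_lt_coshLength (hr i) (hr k) hik
  have hz := one_lt_coshLength (hr i) (hr j) hij
  have ex : edgeLength .hyperbolic I r j k = Real.arcosh (coshLength (r j) (r k) (I {j, k})) := rfl
  have ey : edgeLength .hyperbolic I r i k = Real.arcosh (coshLength (r i) (r k) (I {i, k})) := rfl
  have ez : edgeLength .hyperbolic I r i j = Real.arcosh (coshLength (r i) (r j) (I {i, j})) := rfl
  have pa : 0 < edgeLength .hyperbolic I r j k := ex ▸ Real.arcosh_pos hx
  rw [coshLength_comm (r k) (r i), ← Real.cosh_arcosh hx.le, ← Real.cosh_arcosh hy.le,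
    ← Real.cosh_arcosh hz.le, ← ex, ← ey, ← ez]
  set a := edgeLength .hyperbolic I r j k
  set b := edgeLength .hyperbolic I r i k
  set c := edgeLength .hyperbolic I r i j
  -- Hyperbolic analogue of Heron's factorization: the first factor is positive by `a < b + c`, the
  -- second by `|c - b| < a`.
  have key : (Real.cosh b ^ 2 - 1) * (Real.cosh c ^ 2 - 1)
      - (Real.cosh b * Real.cosh c - Real.cosh a) ^ 2 =
      (Real.cosh (c + b) - Real.cosh a) * (Real.cosh a - Real.cosh (c - b)) := by
    rw [Real.cosh_add, Real.cosh_sub]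
    linear_combination (Real.cosh c ^ 2 - 1) * Real.cosh_sq b
      + Real.sinh b ^ 2 * Real.cosh_sq c
  rw [key]
  refine mul_pos (sub_pos.2 (Real.cosh_lt_cosh.2 ?_)) (sub_pos.2 (Real.cosh_lt_cosh.2 ?_))
  · rw [abs_of_pos pa]
    exact hi.trans_le (le_abs_self _)
  · rw [abs_of_pos pa, abs_lt]
    constructor <;> linarith

/-- The change of the angle at `i` of the triangle `ijk` times the change of the logarithmic radius
at `i`. -/
noncomputable def anglePairing (g : Background) (I : Finset V → ℝ) (r s : V → ℝ) (i j k : V) : ℝ :=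
  logChange g r s i * (angle g I s i j k - angle g I r i j k)

/-- Two circle packings of a triangle which coincide up to scaling in the Euclidean geometry, and
coincide in the hyperbolic geometry. -/
def SameShape (g : Background) (r s : V → ℝ) (i j k : V) : Prop :=
  match g with
  | .euclidean => logChange .euclidean r s i = logChange .euclidean r s j ∧
      logChange .euclidean r s j = logChange .euclidean r s k
  | .hyperbolic => logChange .hyperbolic r s i = 0 ∧ logChange .hyperbolic r s j = 0 ∧
      logChange .hyperbolic r s k = 0

/-- The conditions on the inversive distances of the edges of the triangle `ijk`. -/
def AdmissibleTriangle (I : Finset V → ℝ) (i j k : V) : Prop :=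
  -1 < I {i, j} ∧ -1 < I {i, k} ∧ -1 < I {j, k} ∧ 0 ≤ I {i, j} + I {i, k} * I {j, k} ∧
    0 ≤ I {i, k} + I {i, j} * I {j, k} ∧ 0 ≤ I {j, k} + I {i, j} * I {i, k}

theorem anglePairing_sum_lt (g : Background) {I : Finset V → ℝ} {r s : V → ℝ} (hr : ∀ i, 0 < r i)
    (hs : ∀ i, 0 < s i) {i j k : V} (hI : AdmissibleTriangle I i j k)
    (hi : edgeLength g I r j k < edgeLength g I r i j + edgeLength g I r i k)
    (hj : edgeLength g I r i k < edgeLength g I r i j + edgeLength g I r j k)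
    (hk : edgeLength g I r i j < edgeLength g I r i k + edgeLength g I r j k)
    (hne : ¬ SameShape g r s i j k) :
    anglePairing g I r s i j k + anglePairing g I r s j k i + anglePairing g I r s k i j < 0 := by
  obtain ⟨hij, hik, hjk, h₃, h₂, h₁⟩ := hI
  have hji : -1 < I {j, i} := Finset.pair_comm i j ▸ hij
  have hki : -1 < I {k, i} := Finset.pair_comm i k ▸ hik
  have hkj : -1 < I {k, j} := Finset.pair_comm j k ▸ hjk
  unfold anglePairing
  cases g
  · have := euclidean_pairing_lt (hr i) (hr j) (hr k) (hs i) (hs j) (hs k) hjk hik hij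
      (by linarith) (by linarith) (by linarith) (euclidean_area_pos I hr hij hik hjk hi hj hk)
      (v₁ := logChange .euclidean r s i) (v₂ := logChange .euclidean r s j)
      (v₃ := logChange .euclidean r s k) rfl rfl rfl hne
    rw [angle_euclidean_eq I hr hij hik hjk, angle_euclidean_eq I hs hij hik hjk,
      angle_euclidean_eq I hr hjk hji hki, angle_euclidean_eq I hs hjk hji hki,
      angle_euclidean_eq I hr hki hkj hij, angle_euclidean_eq I hs hki hkj hij,
      Finset.pair_comm j i, Finset.pair_comm k i, Finset.pair_comm k j]
    linarith
  · have := hyperbolic_pairing_lt (hr i) (hr j) (hr k) (hs i) (hs j) (hs k) hjk hik hij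
      (by linarith) (by linarith) (by linarith) (hyperbolic_area_pos I hr hij hik hjk hi hj hk)
      (v₁ := logChange .hyperbolic r s i) (v₂ := logChange .hyperbolic r s j)
      (v₃ := logChange .hyperbolic r s k) rfl rfl rfl hne
    rw [angle_hyperbolic_eq I hr hij hik hjk, angle_hyperbolic_eq I hs hij hik hjk,
      angle_hyperbolic_eq I hr hjk hji hki, angle_hyperbolic_eq I hs hjk hji hki,
      angle_hyperbolic_eq I hr hki hkj hij, angle_hyperbolic_eq I hs hki hkj hij,
      Finset.pair_comm j i, Finset.pair_comm k i, Finset.pair_comm k j]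
    linarith

theorem anglePairing_sum_nonpos (g : Background) {I : Finset V → ℝ} {r s : V → ℝ}
    (hr : ∀ i, 0 < r i) (hs : ∀ i, 0 < s i) {i j k : V} (hI : AdmissibleTriangle I i j k)
    (hi : edgeLength g I r j k < edgeLength g I r i j + edgeLength g I r i k)
    (hj : edgeLength g I r i k < edgeLength g I r i j + edgeLength g I r j k)
    (hk : edgeLength g I r i j < edgeLength g I r i k + edgeLength g I r j k) :
    anglePairing g I r s i j k + anglePairing g I r s j k i + anglePairing g I r s k i j ≤ 0 := by
  by_cases hne : SameShape g r s i j k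
  swap
  · exact (anglePairing_sum_lt g hr hs hI hi hj hk hne).le
  obtain ⟨hij, hik, hjk, h₃, h₂, h₁⟩ := hI
  have hji : -1 < I {j, i} := Finset.pair_comm i j ▸ hij
  have hki : -1 < I {k, i} := Finset.pair_comm i k ▸ hik
  have hkj : -1 < I {k, j} := Finset.pair_comm j k ▸ hjk
  unfold anglePairing
  cases g
  -- With equal logarithmic changes the two triangles are similar, so each angle difference
  -- vanishes.
  · have ei := eq_exp_logChange_mul hr hs i
    have ej := eq_exp_logChange_mul hr hs j
    have ek := eq_exp_logChange_mul hr hs k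
    rw [← hne.2, ← hne.1] at ek
    rw [← hne.1] at ej
    rw [angle_euclidean_eq I hr hij hik hjk, angle_euclidean_eq I hs hij hik hjk,
      angle_euclidean_eq I hr hjk hji hki, angle_euclidean_eq I hs hjk hji hki,
      angle_euclidean_eq I hr hki hkj hij, angle_euclidean_eq I hs hki hkj hij, ei, ej, ek,
      euclideanAngle_scale (Real.exp_pos _), euclideanAngle_scale (Real.exp_pos _),
      euclideanAngle_scale (Real.exp_pos _)]
    simp
  · rw [hne.1, hne.2.1, hne.2.2]
    simp

end InversiveDistance

namespace InversiveDistance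

/-! ### Rigidity -/

section Surface

variable {V : Type*} [DecidableEq V] {K : AbstractSimplicialComplex V} {I : Finset V → ℝ}
  {i j k : V}

theorem IsTriangle.rotate (h : IsTriangle K {i, j, k}) : IsTriangle K {j, k, i} := by
  have : ({j, k, i} : Finset V) = {i, j, k} := by ext; simp; tauto
  rwa [this]

theorem IsTriangle.swap (h : IsTriangle K {i, j, k}) : IsTriangle K {j, i, k} := by
  rwa [Finset.insert_comm]

theorem IsTriangle.isEdge (h : IsTriangle K {i, j, k}) : IsEdge K {i, j} := by
  have hij : i ≠ j := by
    rintro rfl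
    have := h.2
    have := Finset.card_le_two (a := i) (b := k)
    simp_all
  exact ⟨(K.isRelLowerSet_faces h.1).2 (fun x hx => by simp at hx ⊢; tauto) (by simp),
    Finset.card_pair hij⟩

theorem IsTriangle.admissible (hI : ∀ e, IsEdge K e → -1 < I e)
    (hγ : ∀ i j k, IsTriangle K {i, j, k} →
      0 ≤ I {i, j} + I {i, k} * I {j, k} ∧
      0 ≤ I {i, k} + I {i, j} * I {j, k} ∧
      0 ≤ I {j, k} + I {i, j} * I {i, k})
    (h : IsTriangle K {i, j, k}) : AdmissibleTriangle I i j k :=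
  ⟨hI _ h.isEdge, hI _ (Finset.pair_comm k i ▸ h.rotate.rotate.isEdge), hI _ h.rotate.isEdge,
    hγ i j k h⟩

theorem IsPackingMetric.triangle_inequalities {g : Background} {r : V → ℝ}
    (hr : IsPackingMetric g K I r) (h : IsTriangle K {i, j, k}) :
    edgeLength g I r j k < edgeLength g I r i j + edgeLength g I r i k ∧
    edgeLength g I r i k < edgeLength g I r i j + edgeLength g I r j k ∧
    edgeLength g I r i j < edgeLength g I r i k + edgeLength g I r j k := by
  refine ⟨hr.2 i j k h, ?_, ?_⟩
  · have := hr.2 j i k h.swap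
    rwa [edgeLength_comm g I r j i] at this
  · have := hr.2 k i j h.rotate.rotate
    rwa [edgeLength_comm g I r k i, edgeLength_comm g I r k j] at this

end Surface

theorem sum_rotate {V : Type*} [Fintype V] (T : V → V → V → ℝ) :
    ∑ i, ∑ j, ∑ k, T j k i = ∑ i, ∑ j, ∑ k, T i j k := by
  rw [Finset.sum_comm]
  refine Finset.sum_congr rfl fun j _ => ?_
  rw [Finset.sum_comm]

/-- Multiplied by `α²`, the expression becomes `α R` times `(exp Q - exp P)(Q - P)` with `P = α log
x` and `Q = α log y`, which is nonnegative by monotonicity of `exp`. This is where the sign of `α R`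
enters. -/
theorem mul_rpow_sub_mul_log_sub {x y α R : ℝ} (hx : 0 < x) (hy : 0 < y) (h : α * R ≤ 0) :
    R * (y ^ α - x ^ α) * (Real.log y - Real.log x) ≤ 0 ∧
      (α * R ≠ 0 → R * (y ^ α - x ^ α) * (Real.log y - Real.log x) = 0 →
        Real.log y - Real.log x = 0) := by
  rcases eq_or_ne α 0 with rfl | hα
  · simp
  rw [Real.rpow_def_of_pos hx, Real.rpow_def_of_pos hy]
  set p := Real.log x
  set q := Real.log y
  have hmono : 0 ≤ (Real.exp (q * α) - Real.exp (p * α)) * (q * α - p * α) := by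
    rcases le_total (p * α) (q * α) with h | h
    · exact mul_nonneg (sub_nonneg.2 (Real.exp_le_exp.2 h)) (sub_nonneg.2 h)
    · exact mul_nonneg_of_nonpos_of_nonpos (sub_nonpos.2 (Real.exp_le_exp.2 h)) (sub_nonpos.2 h)
  have key : α ^ 2 * (R * (Real.exp (q * α) - Real.exp (p * α)) * (q - p)) =
      (α * R) * ((Real.exp (q * α) - Real.exp (p * α)) * (q * α - p * α)) := by ring
  constructor
  · refine nonpos_of_mul_nonpos_right ?_ (by positivity : 0 < α ^ 2)
    rw [key]
    exact mul_nonpos_of_nonpos_of_nonneg h hmono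
  · intro hne h0
    rw [h0, mul_zero] at key
    rcases mul_eq_zero.1 ((mul_eq_zero.1 key.symm).resolve_left hne) with h | h
    · have := mul_right_cancel₀ hα (Real.exp_injective (sub_eq_zero.1 h))
      rw [this, sub_self]
    · have := mul_right_cancel₀ hα (sub_eq_zero.1 h)
      rw [this, sub_self]

/-! ### Summation over the surface and the equality case -/

section Rigidity

variable {V : Type*} [Fintype V] [DecidableEq V] {K : AbstractSimplicialComplex V}
  {I : Finset V → ℝ} {g : Background} {α : ℝ} {R r s : V → ℝ}

open Classical in
theorem sum_logChange_mul_curvature_sub :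
    -- The factor `1 / 6` is `1 / 2` from the ordered pairs in `curvature` times `1 / 3` from
    -- symmetrizing over the rotations of each triple.
    ∑ i, logChange g r s i * (curvature g K I s i - curvature g K I r i) =
      -(1 / 6) * ∑ i, ∑ j, ∑ k, if IsTriangle K {i, j, k} then
        anglePairing g I r s i j k + anglePairing g I r s j k i + anglePairing g I r s k i j
        else 0 := by
  set T : V → V → V → ℝ := fun i j k =>
    if IsTriangle K {i, j, k} then anglePairing g I r s i j k else 0 with hT
  have h1 : ∑ i, logChange g r s i * (curvature g K I s i - curvature g K I r i) =
      -(1 / 2) * ∑ i, ∑ j, ∑ k, T i j k := by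
    rw [Finset.mul_sum]
    refine Finset.sum_congr rfl fun i _ => ?_
    have : ∑ j, ∑ k, T i j k = logChange g r s i *
        ((∑ j, ∑ k, if IsTriangle K {i, j, k} then angle g I s i j k else 0)
          - ∑ j, ∑ k, if IsTriangle K {i, j, k} then angle g I r i j k else 0) := by
      rw [← Finset.sum_sub_distrib, Finset.mul_sum]
      refine Finset.sum_congr rfl fun j _ => ?_
      rw [← Finset.sum_sub_distrib, Finset.mul_sum]
      refine Finset.sum_congr rfl fun k _ => ?_
      simp only [hT, anglePairing]
      split_ifs <;> simp
    rw [this]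
    unfold curvature
    ring
  have h2 : ∑ i, ∑ j, ∑ k, (if IsTriangle K {i, j, k} then
        anglePairing g I r s i j k + anglePairing g I r s j k i + anglePairing g I r s k i j
        else 0) = ∑ i, ∑ j, ∑ k, (T i j k + T j k i + T k i j) := by
    refine Finset.sum_congr rfl fun i _ => Finset.sum_congr rfl fun j _ =>
      Finset.sum_congr rfl fun k _ => ?_
    simp only [hT]
    by_cases h : IsTriangle K {i, j, k}
    · rw [if_pos h, if_pos h, if_pos h.rotate, if_pos h.rotate.rotate]
    · rw [if_neg h, if_neg h, if_neg fun h' => h h'.rotate.rotate, if_neg fun h' => h h'.rotate]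
      simp
  rw [h1, h2]
  simp only [Finset.sum_add_distrib]
  rw [sum_rotate fun i j k => T j k i, sum_rotate T]
  ring

theorem sameShape_and_logChange_eq_zero (hI : ∀ e, IsEdge K e → -1 < I e)
    (hγ : ∀ i j k, IsTriangle K {i, j, k} →
      0 ≤ I {i, j} + I {i, k} * I {j, k} ∧
      0 ≤ I {i, k} + I {i, j} * I {j, k} ∧
      0 ≤ I {j, k} + I {i, j} * I {i, k})
    (hR : ∀ i, α * R i ≤ 0) (hr : r ∈ metricsWithCurvature g K I α R)
    (hs : s ∈ metricsWithCurvature g K I α R) :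
    (∀ i j k, IsTriangle K {i, j, k} → SameShape g r s i j k) ∧
      ∀ i, α * R i ≠ 0 → logChange g r s i = 0 := by
  classical
  have hcurv : ∀ q ∈ metricsWithCurvature g K I α R, ∀ i,
      curvature g K I q i = R i * scaleFactor g q i ^ α := by
    intro q hq i
    rw [← hq.2 i, alphaCurvature,
      div_mul_cancel₀ _ (Real.rpow_pos_of_pos (scaleFactor_pos g hq.1.1 i) α).ne']
  have hterm : ∀ i, logChange g r s i * (curvature g K I s i - curvature g K I r i) =
      R i * (scaleFactor g s i ^ α - scaleFactor g r i ^ α) *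
        (Real.log (scaleFactor g s i) - Real.log (scaleFactor g r i)) := by
    intro i
    rw [hcurv s hs, hcurv r hr, logChange]
    ring
  have hlog := fun i => mul_rpow_sub_mul_log_sub (scaleFactor_pos g hr.1.1 i)
    (scaleFactor_pos g hs.1.1 i) (hR i)
  have hle : ∀ i ∈ Finset.univ,
      logChange g r s i * (curvature g K I s i - curvature g K I r i) ≤ 0 := fun i _ => by
    rw [hterm]; exact (hlog i).1
  have htri : ∀ i j k, (if IsTriangle K {i, j, k} then
      anglePairing g I r s i j k + anglePairing g I r s j k i + anglePairing g I r s k i j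
      else 0) ≤ 0 := by
    intro i j k
    split_ifs with h
    · obtain ⟨t₁, t₂, t₃⟩ := hr.1.triangle_inequalities h
      exact anglePairing_sum_nonpos g hr.1.1 hs.1.1 (h.admissible hI hγ) t₁ t₂ t₃
    · exact le_rfl
  have hsum := sum_logChange_mul_curvature_sub (K := K) (I := I) (g := g) (r := r) (s := s)
  have hle₁ := Finset.sum_nonpos hle
  have hle₂ : ∑ i, ∑ j, ∑ k, (if IsTriangle K {i, j, k} then
      anglePairing g I r s i j k + anglePairing g I r s j k i + anglePairing g I r s k i j
      else 0) ≤ 0 := Finset.sum_nonpos fun i _ => Finset.sum_nonpos fun j _ =>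
        Finset.sum_nonpos fun k _ => htri i j k
  -- Both sums are nonpositive, and `hsum` makes one a negative multiple of the other.
  have hzero₁ : ∑ i, logChange g r s i * (curvature g K I s i - curvature g K I r i) = 0 := by
    linarith
  have hzero₂ : ∑ i, ∑ j, ∑ k, (if IsTriangle K {i, j, k} then
      anglePairing g I r s i j k + anglePairing g I r s j k i + anglePairing g I r s k i j
      else 0) = 0 := by linarith
  constructor
  · intro i j k h
    have e₁ := (Finset.sum_eq_zero_iff_of_nonpos fun i _ => Finset.sum_nonpos fun j _ =>
      Finset.sum_nonpos fun k _ => htri i j k).1 hzero₂ i (Finset.mem_univ i)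
    have e₂ := (Finset.sum_eq_zero_iff_of_nonpos fun j _ =>
      Finset.sum_nonpos fun k _ => htri i j k).1 e₁ j (Finset.mem_univ j)
    have e₃ := (Finset.sum_eq_zero_iff_of_nonpos fun k _ => htri i j k).1 e₂ k (Finset.mem_univ k)
    rw [if_pos h] at e₃
    by_contra hne
    obtain ⟨t₁, t₂, t₃⟩ := hr.1.triangle_inequalities h
    exact (anglePairing_sum_lt g hr.1.1 hs.1.1 (h.admissible hI hγ) t₁ t₂ t₃ hne).ne e₃
  · intro i hi
    have := (Finset.sum_eq_zero_iff_of_nonpos hle).1 hzero₁ i (Finset.mem_univ i)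
    rw [hterm] at this
    exact (hlog i).2 hi this

theorem IsClosedSurface.exists_triangle_of_isEdge (hK : IsClosedSurface K) {a b : V}
    (h : IsEdge K {a, b}) : ∃ c, IsTriangle K {a, b, c} := by
  obtain ⟨t, ht, hsub⟩ := hK.pure _ h.1
  obtain ⟨c, hc⟩ : (t \ {a, b}).Nonempty := by
    rw [← Finset.card_pos, Finset.card_sdiff_of_subset hsub, ht.2, h.2]
    norm_num
  rw [Finset.mem_sdiff] at hc
  have hcard : ({a, b, c} : Finset V).card = 3 := by
    have : ({a, b, c} : Finset V) = insert c {a, b} := by ext; simp; tauto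
    rw [this, Finset.card_insert_of_notMem hc.2, h.2]
  have : ({a, b, c} : Finset V) = t := by
    refine Finset.eq_of_subset_of_card_le ?_ (by rw [ht.2, hcard])
    intro x hx
    simp only [Finset.mem_insert, Finset.mem_singleton] at hx
    rcases hx with rfl | rfl | rfl
    · exact hsub (by simp)
    · exact hsub (by simp)
    · exact hc.1
  exact ⟨c, this ▸ ht⟩

theorem IsClosedSurface.exists_triangle (hK : IsClosedSurface K) (v : V) :
    ∃ a b, IsTriangle K {v, a, b} := by
  -- A connected graph is nonempty by definition, so every vertex lies on an edge and hence on a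
  -- triangle.
  obtain ⟨w⟩ := (hK.link_connected v).nonempty
  exact ⟨w.1, hK.exists_triangle_of_isEdge w.2⟩

theorem IsClosedSurface.eq_of_sameShape (hK : IsClosedSurface K)
    (h : ∀ i j k, IsTriangle K {i, j, k} → SameShape .euclidean r s i j k) (a b : V) :
    logChange .euclidean r s a = logChange .euclidean r s b := by
  have hedge : ∀ a b, IsEdge K {a, b} →
      logChange .euclidean r s a = logChange .euclidean r s b := by
    intro a b hab
    obtain ⟨c, hc⟩ := hK.exists_triangle_of_isEdge hab
    exact (h a b c hc).1
  obtain ⟨w⟩ := hK.connected.preconnected a b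
  induction w with
  | nil => rfl
  | cons hadj _ ih =>
    refine Eq.trans ?_ ih
    rcases ((SimpleGraph.fromRel_adj _ _ _).1 hadj).2 with h | h
    · exact hedge _ _ h
    · exact (hedge _ _ h).symm

end Rigidity

end InversiveDistance

theorem theorem1p2 {V : Type*} [Fintype V] [DecidableEq V]
    (K : AbstractSimplicialComplex V) (hK : InversiveDistance.IsClosedSurface K)
    (I : Finset V → ℝ) (hI : ∀ e, InversiveDistance.IsEdge K e → -1 < I e)
    (hγ : ∀ i j k, InversiveDistance.IsTriangle K {i, j, k} →
      0 ≤ I {i, j} + I {i, k} * I {j, k} ∧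
      0 ≤ I {i, k} + I {i, j} * I {j, k} ∧
      0 ≤ I {j, k} + I {i, j} * I {i, k})
    (α : ℝ) (R : V → ℝ) :
    ((∀ i, α * R i = 0) →
      ∀ r₁ ∈ InversiveDistance.metricsWithCurvature .euclidean K I α R,
      ∀ r₂ ∈ InversiveDistance.metricsWithCurvature .euclidean K I α R,
        ∃ c : ℝ, 0 < c ∧ ∀ i, r₂ i = c * r₁ i) ∧
    ((∀ i, α * R i ≤ 0) → (∃ i, α * R i ≠ 0) →
      ∀ r₁ ∈ InversiveDistance.metricsWithCurvature .euclidean K I α R,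
      ∀ r₂ ∈ InversiveDistance.metricsWithCurvature .euclidean K I α R, r₁ = r₂) ∧
    ((∀ i, α * R i ≤ 0) →
      ∀ r₁ ∈ InversiveDistance.metricsWithCurvature .hyperbolic K I α R,
      ∀ r₂ ∈ InversiveDistance.metricsWithCurvature .hyperbolic K I α R, r₁ = r₂) := by
  open InversiveDistance in
  refine ⟨fun hR r hr s hs => ?_, fun hR hne r hr s hs => ?_, fun hR r hr s hs => ?_⟩
  · have h := (sameShape_and_logChange_eq_zero hI hγ (fun i => (hR i).le) hr hs).1
    obtain ⟨v⟩ := hK.connected.nonempty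
    refine ⟨Real.exp (logChange .euclidean r s v), Real.exp_pos _, fun i => ?_⟩
    rw [← hK.eq_of_sameShape h i v]
    exact eq_exp_logChange_mul hr.1.1 hs.1.1 i
  · obtain ⟨h, h0⟩ := sameShape_and_logChange_eq_zero hI hγ hR hr hs
    obtain ⟨v, hv⟩ := hne
    funext i
    have := eq_exp_logChange_mul hr.1.1 hs.1.1 i
    rw [hK.eq_of_sameShape h i v, h0 v hv, Real.exp_zero, one_mul] at this
    exact this.symm
  · have h := (sameShape_and_logChange_eq_zero hI hγ hR hr hs).1
    funext i
    obtain ⟨a, b, hab⟩ := hK.exists_triangle i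
    exact eq_of_logChange_eq_zero hr.1.1 hs.1.1 (h i a b hab).1
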